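/- **Setting.** Let $3\le q<p<n$ and $m=n-p$. Consider $y=X\beta+\varepsilon$, with $X$ a fixed $n\times p$ matrix of rank $p$, $\beta\in\mathbb R^p$, and $\varepsilon$ an $n$-dimensional random error with an elliptically contoured Lebesgue density $$f(e)\propto|\sigma^2V|^{-1/2}\,g\!\left(e'V^{-1}e/\sigma^2\right),$$ where $\sigma>0$, $V$ is a known positive definite matrix, $g\ge 0$ is measurable, and $E\|\varepsilon\|^2<\infty$. Let $H$ be a $q\times p$ matrix of rank $q$, let $h\in\mathbb R^q$, and let $H_0:H\beta=h$. Put $$C=X'V^{-1}X,\quad V_1=(HC^{-1}H')^{-1},\quad \tilde\beta=C^{-1}X'V^{-1}y,\quad \hat\beta=\tilde\beta-C^{-1}H'V_1(H\tilde\beta-h),$$ $$S^2=\frac{(y-X\tilde\beta)'V^{-1}(y-X\tilde\beta)}{m},\quad \mathcal L=\frac{(H\tilde\beta-h)'V_1(H\tilde\beta-h)}{qS^2},\quad d=\frac{(q-2)m}{q(m+2)}.$$ Here $\tilde\beta$ is the generalized least squares (GLS) estimator and $\hat\beta$ the restricted estimator. For $0<\alpha<1$ let $F_\alpha$ be the upper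 $\alpha$-percentile of the central $F$-distribution with $(q,m)$ degrees of freedom. The preliminary test, Stein-type and positive-rule estimators are $$\hat\beta^{PT}=\tilde\beta\,1(\mathcal L\ge F_\alpha)+\hat\beta\,1(\mathcal L<F_\alpha),\quad \hat\beta^{S}=\tilde\beta-d\mathcal L^{-1}(\tilde\beta-\hat\beta),\quad \hat\beta^{S+}=\hat\beta+(1-d\mathcal L^{-1})1(\mathcal L>d)(\tilde\beta-\hat\beta).$$ For a positive definite $p\times p$ matrix $W$ let $R_W(\beta^*;\beta)=E[(\beta^*-\beta)'W(\beta^*-\beta)]$. Write $\beta^*\succeq\beta^{**}$ at $\beta$ if $R_W(\beta^*;\beta)\le R_W(\beta^{**};\beta)$. **Theorem.** The risks $R_W$ of all five estimators are finite for every positive definite $W$, every $\alpha\in(0,1)$ and every $\beta$, and the following hold. 1. For every positive definite $W$ and every $\beta\in\mathbb R^p$, $R_W(\hat\beta^{S+};\beta)\le R_W(\hat\beta^{S};\beta)$. 2. For the weight $W=C$ and every $\beta\in\mathbb R^p$, $R_C(\hat\beta^{S+};\beta)\le R_C(\hat\beta^{S};\beta)\le R_C(\tilde\beta;\beta)$.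 3. For every positive definite $W$, every $\alpha\in(0,1)$ and every $\beta$ satisfying $H_0$: * $\hat\beta$ is $\succeq$ each of $\tilde\beta,\hat\beta^{PT},\hat\beta^{S},\hat\beta^{S+}$. * Let $F$ have the central $F$-distribution with $(q+2,m)$ degrees of freedom. Then $$\hat\beta\succeq\hat\beta^{PT}\succeq\hat\beta^{S+}\succeq\hat\beta^{S}\succeq\tilde\beta$$ holds if and only if $$E\!\left[\left(1-\tfrac{qd}{q+2}F^{-1}\right)^2 1\!\left(F\le\tfrac{qd}{q+2}\right)\right]\le P\!\left(F\le\tfrac{qF_\alpha}{q+2}\right)-d .$$ * If $\frac{qF_\alpha}{q+2}$ is smaller than the $d$-quantile of the central $F$-distribution with $(q+2,m)$ degrees of freedom, then $$\hat\beta\succeq\hat\beta^{S+}\succeq\hat\beta^{S}\succeq\hat\beta^{PT}\succeq\tilde\beta .$$ -/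

import Mathlib

open MeasureTheory ProbabilityTheory Matrix
open scoped ENNReal

noncomputable section

namespace EllipticalRegression

/-- The known data of the regression `y = X β + ε` with restriction `H β = h`: the design matrix
`X` of full column rank, the positive definite scale matrix `V` of the errors, and the matrix `H`
(of full row rank) and the vector `h` of the hypothesis `H β = h`. -/
structure Design (n p q : ℕ) where
  X : Matrix (Fin n) (Fin p) ℝ
  V : Matrix (Fin n) (Fin n) ℝ
  H : Matrix (Fin q) (Fin p) ℝ
  h : Fin q → ℝ
  X_rank : X.rank = p
  V_posDef : V.PosDef
  H_rank : H.rank = q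

/-- The random vector `ε` has an elliptically contoured density
`f(e) ∝ |σ² V|^{-1/2} g(e' V⁻¹ e / σ²)` with respect to Lebesgue measure on `ℝⁿ`. -/
def HasEllipticalDensity {Ω : Type*} [MeasurableSpace Ω] {n : ℕ} (P : Measure Ω)
    (ε : Ω → Fin n → ℝ) (σ : ℝ) (V : Matrix (Fin n) (Fin n) ℝ) (g : ℝ → ℝ) : Prop :=
  AEMeasurable ε P ∧
  ∃ c : ℝ, 0 < c ∧
    P.map ε = (volume : Measure (Fin n → ℝ)).withDensity fun e =>
      ENNReal.ofReal (c * (Real.sqrt (σ ^ 2 • V).det)⁻¹ * g ((e ⬝ᵥ V⁻¹ *ᵥ e) / σ ^ 2))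

/-- The central `F`-distribution with `(a, b)` degrees of freedom: the law of
`(χ²_a / a) / (χ²_b / b)` with independent chi-square variables, where `χ²_k` is the Gamma
distribution with shape `k / 2` and rate `1 / 2`. -/
def fDist (a b : ℕ) : Measure ℝ :=
  ((gammaMeasure ((a : ℝ) / 2) (1 / 2)).prod (gammaMeasure ((b : ℝ) / 2) (1 / 2))).map
    fun z => (z.1 / a) / (z.2 / b)

/-- The distribution function of a law on `ℝ`. -/
def distFun (μ : Measure ℝ) (x : ℝ) : ℝ := μ.real (Set.Iic x)

/-- The quantile function (generalized inverse of the distribution function), for levels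
`0 < u < 1`. -/
def quantile (μ : Measure ℝ) (u : ℝ) : ℝ := sInf {x : ℝ | u ≤ distFun μ x}

/-- The upper `α`-percentile `F_α` of the central `F`-distribution with `(a, b)` d.f. -/
def upperF (a b : ℕ) (α : ℝ) : ℝ := quantile (fDist a b) (1 - α)

/-- The shrinkage constant `d = (q - 2)(n - p) / (q (n - p + 2))`. -/
def shrink (n p q : ℕ) : ℝ :=
  (((q : ℝ) - 2) * ((n : ℝ) - p)) / (q * ((n : ℝ) - p + 2))

namespace Design

variable {n p q : ℕ} (D : Design n p q)

/-- `C = X' V⁻¹ X`. -/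
def C : Matrix (Fin p) (Fin p) ℝ := D.Xᵀ * D.V⁻¹ * D.X

/-- `V₁ = (H C⁻¹ H')⁻¹`. -/
def V₁ : Matrix (Fin q) (Fin q) ℝ := (D.H * D.C⁻¹ * D.Hᵀ)⁻¹

/-- The null hypothesis `H₀ : H β = h`. -/
def Null (β : Fin p → ℝ) : Prop := D.H *ᵥ β = D.h

/-- The (unrestricted) generalized least squares estimator. -/
def gls (y : Fin n → ℝ) : Fin p → ℝ := D.C⁻¹ *ᵥ (D.Xᵀ *ᵥ (D.V⁻¹ *ᵥ y))

/-- The restricted estimator. -/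
def restricted (y : Fin n → ℝ) : Fin p → ℝ :=
  D.gls y - D.C⁻¹ *ᵥ (D.Hᵀ *ᵥ (D.V₁ *ᵥ (D.H *ᵥ D.gls y - D.h)))

/-- `S² = (y - X β̃)' V⁻¹ (y - X β̃) / (n - p)`. -/
def S2 (y : Fin n → ℝ) : ℝ :=
  ((y - D.X *ᵥ D.gls y) ⬝ᵥ D.V⁻¹ *ᵥ (y - D.X *ᵥ D.gls y)) / ((n : ℝ) - p)

/-- The test statistic `𝓛 = (H β̃ - h)' V₁ (H β̃ - h) / (q S²)`. -/
def stat (y : Fin n → ℝ) : ℝ :=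
  ((D.H *ᵥ D.gls y - D.h) ⬝ᵥ D.V₁ *ᵥ (D.H *ᵥ D.gls y - D.h)) / (q * D.S2 y)

open Classical in
/-- The preliminary test estimator at level `α`. -/
def prelim (α : ℝ) (y : Fin n → ℝ) : Fin p → ℝ :=
  if upperF q (n - p) α ≤ D.stat y then D.gls y else D.restricted y

/-- The Stein-type shrinkage estimator. -/
def stein (y : Fin n → ℝ) : Fin p → ℝ :=
  D.gls y - (shrink n p q * (D.stat y)⁻¹) • (D.gls y - D.restricted y)

open Classical in
/-- The positive-rule shrinkage estimator. -/
def steinPos (y : Fin n → ℝ) : Fin p → ℝ :=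
  D.restricted y +
    (if shrink n p q < D.stat y then 1 - shrink n p q * (D.stat y)⁻¹ else 0) •
      (D.gls y - D.restricted y)

/-- The weighted quadratic risk `R(δ; β) = E[(δ(y) - β)' W (δ(y) - β)]` of an estimator `δ`, where
`y = X β + ε`, as an extended nonnegative number (the loss is nonnegative for positive definite
`W`). -/
def risk {Ω : Type*} [MeasurableSpace Ω] (P : Measure Ω) (ε : Ω → Fin n → ℝ)
    (W : Matrix (Fin p) (Fin p) ℝ) (δ : (Fin n → ℝ) → Fin p → ℝ) (β : Fin p → ℝ) : ℝ≥0∞ :=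
  ∫⁻ ω, ENNReal.ofReal
    ((δ (D.X *ᵥ β + ε ω) - β) ⬝ᵥ W *ᵥ (δ (D.X *ᵥ β + ε ω) - β)) ∂P

end Design

/-- `E[(1 - (q d / (q + 2)) F⁻¹)² 1(F ≤ q d / (q + 2))]` for a central `F`-variable with
`(q + 2, n - p)` degrees of freedom and `d` the shrinkage constant. -/
def posGain (n p q : ℕ) : ℝ :=
  ∫ x in Set.Iic ((q : ℝ) * shrink n p q / (q + 2)),
    (1 - (q : ℝ) * shrink n p q / (q + 2) * x⁻¹) ^ 2 ∂(fDist (q + 2) (n - p))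

end EllipticalRegression

end

/-! All five estimators have the form `restricted + ψ(stat) • (gls - restricted)` for a scalar
function ψ of the test statistic. `exists_canonicalForm` chooses coordinates (x, v, t) of the error
in dimensions q, p - q, n - p, in which the quadratic form of V⁻¹ is the squared norm. With θ a
linear image of Hβ - h and w = x + θ, the statistic is L = ‖w‖² / (q‖t‖²/m), and the error of an
estimator is B₁(ψ(L) w - θ) + B₂ v. The law of (w, v, t) is `canonicalLaw`, spherical about (θ, 0,
0). The sign change v ↦ -v removes the cross term of the loss, so only the risk of N(ψ(L) w - θ) has
to be compared, where N encodes W and is an isometry for W = C.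

Stein against GLS, W = C. The Stein factor is 1 - k‖t‖²/‖w‖² with k = (q-2)/(m+2). Conditioning on
the squared radius u = ‖w-θ‖² + ‖t‖² makes the density g irrelevant. Then, on every ray of w, an
integration by parts in the radius (`integral_ray_parts`) evaluates the cross term, and the risk
difference becomes a nonpositive multiple of k² (`lintegral_stein_ray`, `lintegral_stein_le`).

Positive rule against Stein, any W. Let χ be the amount by which the Stein factor falls below 0. The
loss difference is at least 2⟨N χw, Nθ⟩, so with M = E[χw] it suffices that ⟨NM, Nθ⟩ ≥ 0. Reflection
in the line of θ preserves the law, hence M = cθ and W no longer matters: only c ≥ 0 is needed when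
θ ≠ 0. For this w is paired with -w. The density need not be monotone, but a radial substitution in
(v, t), whose dimension n - q is at least 2, shows that moving w closer to θ increases the integral
of χ, because χ grows along rays (`lintegral_translate_mono`, `integral_inner_excess_nonneg`).

Null hypothesis, θ = 0. The integrand ‖Nw‖²ψ(L)² is homogeneous of degree two, so its integral is a
factor depending on g times a factor that does not (`lintegral_homogeneous`), and g may be replaced
by the Gaussian. There the quadratic weight turns the chi-square of ‖w‖² from q into q + 2 degrees
of freedom, and every risk is K E[ψ(((q+2)/q) F)²] + c with the same K and c
(`lintegral_canonicalLaw_null`, `exists_null_risk`). The five expectations are 0, 1, 1 - P(F ≤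
qF_α/(q+2)), 1 - d and 1 - d - `posGain`, and the orderings are comparisons of these numbers. -/

noncomputable section

namespace EllipticalRegression

/-! ### Polar coordinates and monotonicity under translation of a radial density. -/

section Polar

variable {E : Type*} [NormedAddCommGroup E] [NormedSpace ℝ E] [FiniteDimensional ℝ E]
  [MeasurableSpace E] [BorelSpace E]

/-- Integration in polar coordinates. -/
theorem lintegral_polar [Nontrivial E] (μ : Measure E) [μ.IsAddHaarMeasure] {f : E → ℝ≥0∞}
    (hf : Measurable f) :
    ∫⁻ x, f x ∂μ = ∫⁻ s : Metric.sphere (0 : E) 1, (∫⁻ r in Set.Ioi (0 : ℝ),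
      ENNReal.ofReal (r ^ (Module.finrank ℝ E - 1)) * f (r • (s : E))) ∂μ.toSphere := by
  have h1 : ∫⁻ x, f x ∂μ = ∫⁻ x : ({0}ᶜ : Set E), f x ∂(μ.comap (↑)) := by
    rw [lintegral_subtype_comap (measurableSet_singleton _).compl,
      restrict_compl_singleton]
  have h2 := (μ.measurePreserving_homeomorphUnitSphereProd).symm
    (homeomorphUnitSphereProd E).toMeasurableEquiv
  have h3 := h2.lintegral_comp_emb (MeasurableEquiv.measurableEmbedding _)
    (fun x : ({0}ᶜ : Set E) => f x)
  rw [h1, ← h3, lintegral_prod]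
  · refine lintegral_congr fun s => ?_
    rw [Measure.volumeIoiPow, lintegral_withDensity_eq_lintegral_mul]
    · rw [← lintegral_subtype_comap measurableSet_Ioi]
      rfl
    · fun_prop
    · exact hf.comp (measurable_subtype_coe.comp ((MeasurableEquiv.measurable _).comp
        measurable_prodMk_left))
  · exact (hf.comp (measurable_subtype_coe.comp (MeasurableEquiv.measurable _))).aemeasurable

/-- Radial substitution: along a ray, translating the argument `c * ρ ^ 2` of a nonnegative
function to the right decreases its integral against a weight that increases along the ray. -/
theorem lintegral_ray_mono {N : ℕ} (hN : 2 ≤ N) {a b c : ℝ} (hc : 0 < c) (hab : a ≤ b)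
    (g Φ : ℝ → ℝ≥0∞) (hΦ : MonotoneOn Φ (Set.Ioi 0)) :
    ∫⁻ r in Set.Ioi (0 : ℝ), ENNReal.ofReal (r ^ (N - 1)) * (g (b + c * r ^ 2) * Φ r) ≤
      ∫⁻ r in Set.Ioi (0 : ℝ), ENNReal.ofReal (r ^ (N - 1)) * (g (a + c * r ^ 2) * Φ r) := by
  -- The shift δ is chosen so that b + c r² = a + c h(r)² for h(r) = √(r² + δ).
  set δ := (b - a) / c with hδ
  have hδ0 : 0 ≤ δ := div_nonneg (by linarith) hc.le
  set h : ℝ → ℝ := fun r => Real.sqrt (r ^ 2 + δ) with hh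
  have hpos : ∀ r ∈ Set.Ioi (0 : ℝ), 0 < h r := fun r hr => by
    have : 0 < r := hr
    exact Real.sqrt_pos.2 (by positivity)
  have hle : ∀ r ∈ Set.Ioi (0 : ℝ), r ≤ h r := fun r hr => by
    have : 0 < r := hr
    exact Real.le_sqrt_of_sq_le (by linarith)
  have hsq : ∀ r ∈ Set.Ioi (0 : ℝ), h r ^ 2 = r ^ 2 + δ := fun r hr => by
    exact Real.sq_sqrt (by positivity)
  have hder : ∀ r ∈ Set.Ioi (0 : ℝ), HasDerivWithinAt h (r / h r) (Set.Ioi 0) r := by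
    intro r hr
    have : 0 < r := hr
    have h1 : HasDerivAt (fun r : ℝ => r ^ 2 + δ) (2 * r) r := by
      simpa using (hasDerivAt_pow 2 r).add_const δ
    have h2 := (h1.sqrt (by positivity)).hasDerivWithinAt (s := Set.Ioi 0)
    refine h2.congr_deriv ?_
    rw [mul_div_mul_left _ _ two_ne_zero]
  have hinj : Set.InjOn h (Set.Ioi 0) := by
    intro x hx y hy hxy
    have h1 : h x ^ 2 = h y ^ 2 := by rw [hxy]
    rw [hsq x hx, hsq y hy] at h1
    have hx' : 0 < x := hx
    have hy' : 0 < y := hy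
    nlinarith
  have himg := lintegral_image_eq_lintegral_abs_deriv_mul measurableSet_Ioi hder hinj
    (fun r => ENNReal.ofReal (r ^ (N - 1)) * (g (a + c * r ^ 2) * Φ r))
  have hsub : h '' Set.Ioi 0 ⊆ Set.Ioi 0 := by
    rintro _ ⟨r, hr, rfl⟩
    exact hpos r hr
  -- The image of `h` may miss an initial piece of the half-line; discarding that piece only lowers
  -- the larger side.
  refine le_trans ?_ (lintegral_mono_set hsub)
  rw [himg]
  refine setLIntegral_mono' measurableSet_Ioi fun r hr => ?_
  have hr0 : 0 < r := hr
  rw [← mul_assoc, ← mul_assoc, ← mul_assoc]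
  have e1 : a + c * h r ^ 2 = b + c * r ^ 2 := by
    rw [hsq r hr, hδ]; field_simp; ring
  rw [e1]
  refine mul_le_mul' (mul_le_mul' ?_ le_rfl) (hΦ hr (hpos r hr) (hle r hr))
  rw [← ENNReal.ofReal_mul (abs_nonneg _)]
  refine ENNReal.ofReal_le_ofReal ?_
  -- The Jacobian r / h(r) costs one power of h(r), so r^(N-1) ≤ h(r)^(N-1) · r / h(r) amounts to
  -- r^(N-2) ≤ h(r)^(N-2). This is where dimension at least 2 is needed.
  obtain ⟨k, rfl⟩ := Nat.exists_eq_add_of_le hN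
  have hp := hpos r hr
  rw [abs_of_nonneg (by positivity), show 2 + k - 1 = k + 1 by omega, pow_succ, pow_succ]
  have : r ^ k ≤ h r ^ k := pow_le_pow_left₀ hr0.le (hle r hr) k
  calc r ^ k * r ≤ h r ^ k * r := by gcongr
    _ = _ := by field_simp

/-- Translating the argument of a nonnegative function of a quadratic gauge `Q` to the right
decreases its integral against a weight that increases along rays. -/
theorem lintegral_translate_mono (μ : Measure E) [μ.IsAddHaarMeasure]
    (hN : 2 ≤ Module.finrank ℝ E) {a b : ℝ} (hab : a ≤ b) {g : ℝ → ℝ≥0∞} (hg : Measurable g)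
    {Q : E → ℝ} (hQm : Measurable Q) (hQ : ∀ (r : ℝ) (y : E), Q (r • y) = r ^ 2 * Q y)
    (hQ0 : ∀ y, y ≠ 0 → 0 < Q y)
    {Φ : E → ℝ≥0∞} (hΦm : Measurable Φ)
    (hΦ : ∀ (y : E) (r : ℝ), 1 ≤ r → Φ y ≤ Φ (r • y)) :
    ∫⁻ y, g (b + Q y) * Φ y ∂μ ≤ ∫⁻ y, g (a + Q y) * Φ y ∂μ := by
  have : Nontrivial E := Module.nontrivial_of_finrank_pos (R := ℝ) (by omega)
  rw [lintegral_polar μ (by fun_prop), lintegral_polar μ (by fun_prop)]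
  refine lintegral_mono fun s => ?_
  have hs : (s : E) ≠ 0 := ne_zero_of_mem_unit_sphere s
  simp only [hQ]
  have := lintegral_ray_mono hN (hQ0 _ hs) hab g (fun r => Φ (r • (s : E))) (by
    intro r hr r' hr' hrr
    have hr0 : (0 : ℝ) < r := hr
    have := hΦ (r • (s : E)) (r' / r) ((one_le_div hr0).2 hrr)
    simpa [smul_smul, div_mul_cancel₀ _ hr0.ne'] using this)
  simpa only [mul_comm (Q (s : E))] using this

end Polar

/-! ### Differentiability of powers of the truncated square root. -/

section Ray

/-- `x ↦ (√x) ^ (j + 2)` is continuously differentiable for `j ≥ 1`. -/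
theorem hasDerivAt_sqrt_pow {j : ℕ} (hj : 1 ≤ j) (x : ℝ) :
    HasDerivAt (fun x => Real.sqrt x ^ (j + 2)) (((j : ℝ) + 2) / 2 * Real.sqrt x ^ j) x := by
  rcases lt_trichotomy x 0 with hx | rfl | hx
  · have h0 : (fun x => Real.sqrt x ^ (j + 2)) =ᶠ[nhds x] fun _ => 0 := by
      filter_upwards [eventually_lt_nhds hx] with y hy
      simp [Real.sqrt_eq_zero_of_nonpos hy.le]
    rw [Real.sqrt_eq_zero_of_nonpos hx.le, zero_pow (by omega), mul_zero]
    exact (hasDerivAt_const x (0 : ℝ)).congr_of_eventuallyEq h0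
  · rw [Real.sqrt_zero, zero_pow (by omega), mul_zero, hasDerivAt_iff_tendsto_slope_zero]
    have hc : Filter.Tendsto (fun t : ℝ => Real.sqrt t ^ j) (nhds 0) (nhds 0) := by
      have : Continuous fun t : ℝ => Real.sqrt t ^ j := by fun_prop
      simpa [show j ≠ 0 by omega] using this.tendsto 0
    refine squeeze_zero_norm (fun t => ?_) (hc.mono_left nhdsWithin_le_nhds)
    rcases le_or_gt t 0 with ht | ht
    · simp [Real.sqrt_eq_zero_of_nonpos ht, show j ≠ 0 by omega]
    · have h2 : Real.sqrt t ^ 2 = t := Real.sq_sqrt ht.le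
      simp only [zero_add, Real.sqrt_zero, ne_eq, Nat.add_eq_zero_iff, OfNat.ofNat_ne_zero,
        and_false, not_false_eq_true, zero_pow, sub_zero, smul_eq_mul, norm_mul, norm_inv,
        norm_pow, Real.norm_eq_abs]
      rw [pow_add, sq_abs, h2, abs_of_pos ht, abs_of_nonneg (Real.sqrt_nonneg t)]
      exact le_of_eq (by field_simp)
  · have h1 := (Real.hasDerivAt_sqrt hx.ne').pow (j + 2)
    refine h1.congr_deriv ?_
    have : 0 < Real.sqrt x := Real.sqrt_pos.2 hx
    rw [show j + 2 - 1 = j + 1 by omega, pow_succ]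
    push_cast
    field_simp

end Ray

/-! ### Stein's identity and inequality along a ray. -/

section SteinRay

/-- Integration by parts along a ray, where `b r = r ^ 2 - 2 * c * r + τ` is the squared distance
from the point at distance `r` on the ray to a fixed centre. -/
theorem integral_ray_parts {q m : ℕ} (hq : 3 ≤ q) (hm : 1 ≤ m) (c τ u : ℝ) :
    Integrable (fun r : ℝ => r ^ (q - 2) *
      Real.sqrt (u - (r ^ 2 - 2 * c * r + τ)) ^ m * (r - c)) ∧
    Integrable (fun r : ℝ => r ^ (q - 3) * Real.sqrt (u - (r ^ 2 - 2 * c * r + τ)) ^ (m + 2)) ∧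
    ((q : ℝ) - 2) * ∫ r in Set.Ioi (0 : ℝ),
        r ^ (q - 3) * Real.sqrt (u - (r ^ 2 - 2 * c * r + τ)) ^ (m + 2) =
      ((m : ℝ) + 2) * ∫ r in Set.Ioi (0 : ℝ),
        r ^ (q - 2) * Real.sqrt (u - (r ^ 2 - 2 * c * r + τ)) ^ m * (r - c) := by
  obtain ⟨j, rfl⟩ := Nat.exists_eq_add_of_le hq
  rw [show 3 + j - 2 = j + 1 by omega, show 3 + j - 3 = j by omega]
  set s : ℝ → ℝ := fun r => Real.sqrt (u - (r ^ 2 - 2 * c * r + τ)) with hs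
  -- For |r| ≥ R the quadratic exceeds u, so the truncated root vanishes and all integrands have
  -- compact support.
  set R : ℝ := 2 * |c| + |u| + |τ| + 1 with hR
  have hs0 : ∀ r : ℝ, R ≤ |r| → s r = 0 := by
    intro r hr
    refine Real.sqrt_eq_zero_of_nonpos ?_
    have h1 : c * r ≤ |c| * |r| := by rw [← abs_mul]; exact le_abs_self _
    have h2 : r ^ 2 = |r| ^ 2 := (sq_abs r).symm
    have h3 := le_abs_self u
    have h4 := neg_abs_le τ
    have h5 := abs_nonneg u
    have h6 := abs_nonneg τ
    have h7 := abs_nonneg c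
    nlinarith [mul_nonneg (show 0 ≤ |r| - 1 by linarith) (show 0 ≤ |u| + |τ| by linarith),
      mul_nonneg (show 0 ≤ |r| by positivity) (show 0 ≤ |r| - R by linarith)]
  have hscont : Continuous s := by fun_prop
  have hout : ∀ r : ℝ, r ∉ Set.Icc (-R) R → R ≤ |r| := by
    intro r hr
    by_contra h
    exact hr (abs_le.1 (not_le.1 h).le)
  have hi1 : Integrable (fun r : ℝ => r ^ (j + 1) * s r ^ m * (r - c)) := by
    refine Continuous.integrable_of_hasCompactSupport (by fun_prop)
      (HasCompactSupport.intro (isCompact_Icc (a := -R) (b := R)) fun r hr => ?_)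
    rw [hs0 r (hout r hr), zero_pow (by omega)]; ring
  have hi2 : Integrable (fun r : ℝ => r ^ j * s r ^ (m + 2)) := by
    refine Continuous.integrable_of_hasCompactSupport (by fun_prop)
      (HasCompactSupport.intro (isCompact_Icc (a := -R) (b := R)) fun r hr => ?_)
    rw [hs0 r (hout r hr), zero_pow (by omega)]; ring
  refine ⟨hi1, hi2, ?_⟩
  -- The primitive r^(q-2) s(r)^(m+2) vanishes at 0 because q - 2 ≥ 1, and for large r because s
  -- does; hence the two parts of its derivative have equal integrals.
  have hder : ∀ r ∈ Set.Ici (0 : ℝ), HasDerivAt (fun r => r ^ (j + 1) * s r ^ (m + 2))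
      (((j : ℝ) + 1) * (r ^ j * s r ^ (m + 2)) -
        ((m : ℝ) + 2) * (r ^ (j + 1) * s r ^ m * (r - c))) r := by
    intro r _
    have h1 : HasDerivAt (fun r : ℝ => u - (r ^ 2 - 2 * c * r + τ)) (-(2 * r - 2 * c)) r := by
      have := (((hasDerivAt_pow 2 r).sub ((hasDerivAt_id r).const_mul (2 * c))).add_const
        τ).const_sub u
      refine this.congr_deriv ?_
      simp
    have h2 := (hasDerivAt_sqrt_pow hm (u - (r ^ 2 - 2 * c * r + τ))).comp r h1
    refine ((hasDerivAt_pow (j + 1) r).mul h2).congr_deriv ?_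
    simp only [Function.comp, hs, Nat.add_sub_cancel]
    push_cast
    ring
  have hlim : Filter.Tendsto (fun r => r ^ (j + 1) * s r ^ (m + 2)) Filter.atTop (nhds 0) := by
    refine tendsto_const_nhds.congr' ?_
    filter_upwards [Filter.eventually_ge_atTop R] with r hr
    rw [hs0 r (hr.trans (le_abs_self r)), zero_pow (by omega), mul_zero]
  have hint := integral_Ioi_of_hasDerivAt_of_tendsto' hder
    ((hi2.const_mul _).sub (hi1.const_mul _)).integrableOn hlim
  rw [integral_sub (hi2.const_mul _).integrableOn (hi1.const_mul _).integrableOn,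
    integral_const_mul, integral_const_mul] at hint
  simp only [ne_eq, Nat.add_eq_zero_iff, one_ne_zero, and_false, not_false_eq_true, zero_pow,
    zero_mul, sub_zero] at hint
  push_cast
  linarith

/-- The Stein inequality along a ray, for the uniform distribution on a sphere of squared
radius `u`. -/
theorem lintegral_stein_ray {q m : ℕ} (hq : 3 ≤ q) (hm : 1 ≤ m) {c τ : ℝ} (hc : c ^ 2 ≤ τ)
    (u : ℝ) {k : ℝ} (hk : k = ((q : ℝ) - 2) / (m + 2)) {b s : ℝ → ℝ}
    (hb : ∀ r, b r = r ^ 2 - 2 * c * r + τ) (hs : ∀ r, s r = Real.sqrt (u - b r)) :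
    ∫⁻ r in Set.Ioi (0 : ℝ), ENNReal.ofReal (r ^ (q - 1)) *
        (ENNReal.ofReal (s r ^ (m - 1) / (2 * s r)) *
          ENNReal.ofReal (b r - 2 * k * s r ^ 2 * (r - c) / r + k ^ 2 * s r ^ 4 / r ^ 2)) ≤
      ∫⁻ r in Set.Ioi (0 : ℝ), ENNReal.ofReal (r ^ (q - 1)) *
        (ENNReal.ofReal (s r ^ (m - 1) / (2 * s r)) * ENNReal.ofReal (b r)) := by
  obtain ⟨hi1, hi2, hparts⟩ := integral_ray_parts hq hm c τ u
  simp only [← hb, ← hs] at hi1 hi2 hparts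
  have hq2 : (0 : ℝ) < (q : ℝ) - 2 := by
    have : (3 : ℝ) ≤ q := by exact_mod_cast hq
    linarith
  have hs0 : ∀ r, 0 ≤ s r := fun r => by rw [hs]; exact Real.sqrt_nonneg _
  have hb0 : ∀ r, 0 ≤ b r := fun r => by rw [hb]; nlinarith [sq_nonneg (r - c)]
  have hbm : Measurable b := by
    rw [show b = fun r => r ^ 2 - 2 * c * r + τ from funext hb]; fun_prop
  have hsm : Measurable s := by
    rw [show s = fun r => Real.sqrt (u - b r) from funext hs]; fun_prop
  obtain ⟨j, rfl⟩ := Nat.exists_eq_add_of_le hq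
  obtain ⟨i, rfl⟩ := Nat.exists_eq_add_of_le hm
  -- Multiplied by the weight s^(m-1)/(2s), the loss splits into `f0 - k f1 + (k²/2) f2`. The
  -- factors s² and s⁴ absorb the singularity of the weight in `f1` and `f2`.
  set f0 : ℝ → ℝ := fun r => r ^ (3 + j - 1) * (s r ^ (1 + i - 1) / (2 * s r) * b r) with hf0
  set f1 : ℝ → ℝ := fun r => r ^ (3 + j - 2) * s r ^ (1 + i) * (r - c) with hf1
  set f2 : ℝ → ℝ := fun r => r ^ (3 + j - 3) * s r ^ (1 + i + 2) with hf2
  have hR : ∫⁻ r in Set.Ioi (0 : ℝ), ENNReal.ofReal (r ^ (3 + j - 1)) *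
        (ENNReal.ofReal (s r ^ (1 + i - 1) / (2 * s r)) * ENNReal.ofReal (b r)) =
      ∫⁻ r in Set.Ioi (0 : ℝ), ENNReal.ofReal (f0 r) := by
    refine setLIntegral_congr_fun measurableSet_Ioi fun r hr => ?_
    have hr0 : (0 : ℝ) < r := hr
    have := hs0 r
    simp only [hf0]
    rw [ENNReal.ofReal_mul (by positivity), ENNReal.ofReal_mul (by positivity)]
  have hL : ∫⁻ r in Set.Ioi (0 : ℝ), ENNReal.ofReal (r ^ (3 + j - 1)) *
        (ENNReal.ofReal (s r ^ (1 + i - 1) / (2 * s r)) *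
          ENNReal.ofReal (b r - 2 * k * s r ^ 2 * (r - c) / r + k ^ 2 * s r ^ 4 / r ^ 2)) =
      ∫⁻ r in Set.Ioi (0 : ℝ), ENNReal.ofReal (f0 r - k * f1 r + k ^ 2 / 2 * f2 r) := by
    refine setLIntegral_congr_fun measurableSet_Ioi fun r hr => ?_
    have hr0 : (0 : ℝ) < r := hr
    have hsr := hs0 r
    rw [← ENNReal.ofReal_mul (by positivity), ← ENNReal.ofReal_mul (by positivity)]
    congr 1
    simp only [hf0, hf1, hf2, show 3 + j - 1 = j + 2 by omega, show 3 + j - 2 = j + 1 by omega,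
      show 3 + j - 3 = j by omega, show 1 + i - 1 = i by omega]
    rcases hsr.eq_or_lt with h0 | h0
    · rw [← h0]; simp [pow_add]
    · field_simp
      ring
  have hnn : ∀ r ∈ Set.Ioi (0 : ℝ), 0 ≤ f0 r - k * f1 r + k ^ 2 / 2 * f2 r := by
    intro r hr
    have hr0 : (0 : ℝ) < r := hr
    have hsr := hs0 r
    simp only [hf0, hf1, hf2, show 3 + j - 1 = j + 2 by omega, show 3 + j - 2 = j + 1 by omega,
      show 3 + j - 3 = j by omega, show 1 + i - 1 = i by omega]
    rcases hsr.eq_or_lt with h0 | h0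
    · rw [← h0]; simp [pow_add]
    -- Completing the square shows the shrunken loss as a squared distance along the ray plus the
    -- squared distance τ - c² of the centre from the line.
    · have : r ^ (j + 2) * (s r ^ i / (2 * s r) * b r) - k * (r ^ (j + 1) * s r ^ (1 + i) *
          (r - c)) + k ^ 2 / 2 * (r ^ j * s r ^ (1 + i + 2)) =
          r ^ (j + 2) * (s r ^ i / (2 * s r)) * ((r - c - k * s r ^ 2 / r) ^ 2 + (τ - c ^ 2)) := by
        rw [hb]
        field_simp
        ring
      rw [this]
      have : 0 ≤ τ - c ^ 2 := by linarith
      positivity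
  rw [hR, hL]
  -- An infinite right-hand side is trivial; otherwise `f0` is integrable and the comparison can be
  -- made with real integrals.
  by_cases htop : ∫⁻ r in Set.Ioi (0 : ℝ), ENNReal.ofReal (f0 r) = ⊤
  · rw [htop]; exact le_top
  have hf0n : ∀ᵐ r ∂volume.restrict (Set.Ioi (0 : ℝ)), 0 ≤ f0 r := by
    refine (ae_restrict_iff' measurableSet_Ioi).2 (ae_of_all _ fun r hr => ?_)
    have hr0 : (0 : ℝ) < r := hr
    have := hs0 r
    have := hb0 r
    positivity
  have hi0 : IntegrableOn f0 (Set.Ioi 0) := by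
    refine ⟨by fun_prop, ?_⟩
    rw [hasFiniteIntegral_iff_ofReal hf0n]
    exact lt_top_iff_ne_top.2 htop
  have hi1' : IntegrableOn f1 (Set.Ioi 0) := hi1.integrableOn
  have hi2' : IntegrableOn f2 (Set.Ioi 0) := hi2.integrableOn
  have hi : IntegrableOn (fun r => f0 r - k * f1 r + k ^ 2 / 2 * f2 r) (Set.Ioi 0) :=
    (hi0.sub (hi1'.const_mul k)).add (hi2'.const_mul _)
  have hi01 : IntegrableOn (fun r => f0 r - k * f1 r) (Set.Ioi 0) := hi0.sub (hi1'.const_mul k)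
  rw [← ofReal_integral_eq_lintegral_ofReal hi0 hf0n,
    ← ofReal_integral_eq_lintegral_ofReal hi
      ((ae_restrict_iff' measurableSet_Ioi).2 (ae_of_all _ hnn))]
  refine ENNReal.ofReal_le_ofReal ?_
  have e : ∫ r in Set.Ioi (0 : ℝ), (f0 r - k * f1 r + k ^ 2 / 2 * f2 r) =
      (∫ r in Set.Ioi (0 : ℝ), f0 r) - k * (∫ r in Set.Ioi (0 : ℝ), f1 r) +
        k ^ 2 / 2 * ∫ r in Set.Ioi (0 : ℝ), f2 r := by
    rw [← integral_const_mul, ← integral_const_mul, ← integral_sub hi0 (hi1'.const_mul k),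
      ← integral_add hi01 (hi2'.const_mul _)]
  -- With this identity the risk changes by (-k² + k²/2)∫f2 ≤ 0; the value k = (q-2)/(m+2) minimises
  -- the quadratic in the shrinkage constant.
  have e1 : ∫ r in Set.Ioi (0 : ℝ), f1 r = k * ∫ r in Set.Ioi (0 : ℝ), f2 r := by
    rw [hk, div_mul_eq_mul_div, hparts]
    field_simp
  have e2 : 0 ≤ ∫ r in Set.Ioi (0 : ℝ), f2 r := by
    refine setIntegral_nonneg measurableSet_Ioi fun r hr => ?_
    have hr0 : (0 : ℝ) < r := hr
    have := hs0 r
    positivity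
  calc _ = _ := e
    _ ≤ _ := by rw [e1]; nlinarith [mul_nonneg (sq_nonneg k) e2]

end SteinRay

/-! ### Mixture over the squared radius, and Stein's inequality for spherical laws. -/

section Radial

variable {E F : Type*} [NormedAddCommGroup E] [InnerProductSpace ℝ E] [FiniteDimensional ℝ E]
  [MeasurableSpace E] [BorelSpace E] [NormedAddCommGroup F] [InnerProductSpace ℝ F]
  [FiniteDimensional ℝ F] [MeasurableSpace F] [BorelSpace F]

/-- Integrals of radial functions in terms of the shifted squared radius `u = b + ‖t‖ ^ 2`. -/
theorem lintegral_radial [Nontrivial F] {m : ℕ} (hm : Module.finrank ℝ F = m) (b : ℝ)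
    {f : ℝ → ℝ → ℝ≥0∞} (hf : Measurable (Function.uncurry f)) :
    ∫⁻ t : F, f (b + ‖t‖ ^ 2) (‖t‖ ^ 2) = (volume : Measure F).toSphere Set.univ *
      ∫⁻ u, ENNReal.ofReal (Real.sqrt (u - b) ^ (m - 1) / (2 * Real.sqrt (u - b))) *
        f u (u - b) := by
  rw [lintegral_polar volume (by fun_prop)]
  have hn : ∀ (s : Metric.sphere (0 : F) 1), ∫⁻ r in Set.Ioi (0 : ℝ),
      ENNReal.ofReal (r ^ (Module.finrank ℝ F - 1)) *
        f (b + ‖r • (s : F)‖ ^ 2) (‖r • (s : F)‖ ^ 2) =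
      ∫⁻ u, ENNReal.ofReal (Real.sqrt (u - b) ^ (m - 1) / (2 * Real.sqrt (u - b))) *
        f u (u - b) := by
    intro s
    -- For u ≤ b the root is 0 and division by 0 gives 0, so the weight itself restricts the
    -- integral to u > b.
    have h0 : ∫⁻ u, ENNReal.ofReal (Real.sqrt (u - b) ^ (m - 1) / (2 * Real.sqrt (u - b))) *
        f u (u - b) = ∫⁻ u in Set.Ioi b,
          ENNReal.ofReal (Real.sqrt (u - b) ^ (m - 1) / (2 * Real.sqrt (u - b))) *
        f u (u - b) := by
      rw [← lintegral_indicator measurableSet_Ioi]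
      refine lintegral_congr fun u => ?_
      rw [Set.indicator_apply]
      split_ifs with h
      · rfl
      · have : Real.sqrt (u - b) = 0 := Real.sqrt_eq_zero_of_nonpos (by simpa using h)
        simp [this]
    have hder : ∀ u ∈ Set.Ioi b, HasDerivWithinAt (fun u => Real.sqrt (u - b))
        (1 / (2 * Real.sqrt (u - b))) (Set.Ioi b) u := by
      intro u hu
      have : u - b ≠ 0 := (sub_pos.2 hu).ne'
      exact (((hasDerivAt_id u).sub_const b).sqrt this).hasDerivWithinAt
    have hinj : Set.InjOn (fun u => Real.sqrt (u - b)) (Set.Ioi b) := by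
      intro x hx y hy hxy
      have := (Real.sqrt_inj (sub_pos.2 hx).le (sub_pos.2 hy).le).1 hxy
      linarith
    have himg : (fun u => Real.sqrt (u - b)) '' Set.Ioi b = Set.Ioi 0 := by
      ext r
      constructor
      · rintro ⟨u, hu, rfl⟩
        exact Real.sqrt_pos.2 (sub_pos.2 hu)
      · intro hr
        have hr0 : (0 : ℝ) < r := hr
        refine ⟨b + r ^ 2, ?_, ?_⟩
        · simp only [Set.mem_Ioi]; nlinarith
        · simp [Real.sqrt_sq hr0.le]
    have := lintegral_image_eq_lintegral_abs_deriv_mul measurableSet_Ioi hder hinj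
      (fun r => ENNReal.ofReal (r ^ (m - 1)) * f (b + r ^ 2) (r ^ 2))
    rw [himg] at this
    rw [h0, hm]
    refine Eq.trans ?_ (this.trans ?_)
    · refine setLIntegral_congr_fun measurableSet_Ioi fun r hr => ?_
      have hr0 : (0 : ℝ) < r := hr
      simp [norm_smul, abs_of_pos hr0]
    · refine setLIntegral_congr_fun measurableSet_Ioi fun u hu => ?_
      have hu0 : 0 < u - b := sub_pos.2 hu
      simp only [Real.sq_sqrt hu0.le]
      rw [← mul_assoc, ← ENNReal.ofReal_mul (abs_nonneg _), abs_of_nonneg (by positivity)]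
      rw [one_div_mul_eq_div, add_sub_cancel]
  simp only [hn, lintegral_const]
  rw [mul_comm]

/-- Mixture representation: integrals against a spherical density, in terms of the squared radius
`u` and of polar coordinates for the first component. -/
theorem lintegral_mixture [Nontrivial E] [Nontrivial F] {q m : ℕ} (hE : Module.finrank ℝ E = q)
    (hF : Module.finrank ℝ F = m) {g : ℝ → ℝ≥0∞} (hg : Measurable g) (θ : E)
    {ℓ : E → ℝ → ℝ≥0∞} (hℓ : Measurable (Function.uncurry ℓ)) :
    ∫⁻ w : E, ∫⁻ t : F, g (‖w - θ‖ ^ 2 + ‖t‖ ^ 2) * ℓ w (‖t‖ ^ 2) =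
      (volume : Measure F).toSphere Set.univ * ∫⁻ u, g u *
        ∫⁻ s : Metric.sphere (0 : E) 1, (∫⁻ r in Set.Ioi (0 : ℝ),
          ENNReal.ofReal (r ^ (q - 1)) *
          (ENNReal.ofReal (Real.sqrt (u - ‖r • (s : E) - θ‖ ^ 2) ^ (m - 1) /
            (2 * Real.sqrt (u - ‖r • (s : E) - θ‖ ^ 2))) *
            ℓ (r • (s : E)) (u - ‖r • (s : E) - θ‖ ^ 2))) ∂(volume : Measure E).toSphere := by
  obtain ⟨κ, hκ⟩ : ∃ κ : E → ℝ → ℝ≥0∞, κ = fun w u => ENNReal.ofReal (Real.sqrt (u - ‖w - θ‖ ^ 2) ^ (m - 1) /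
    (2 * Real.sqrt (u - ‖w - θ‖ ^ 2))) * ℓ w (u - ‖w - θ‖ ^ 2) := ⟨_, rfl⟩
  have hmeas : Measurable (Function.uncurry κ) := by
    have h2 : Measurable fun z : E × ℝ => ℓ z.1 (z.2 - ‖z.1 - θ‖ ^ 2) :=
      hℓ.comp (measurable_fst.prodMk
        (by fun_prop : Measurable fun z : E × ℝ => z.2 - ‖z.1 - θ‖ ^ 2))
    rw [hκ]
    unfold Function.uncurry
    fun_prop
  have h1 : ∀ w : E, ∫⁻ t : F, g (‖w - θ‖ ^ 2 + ‖t‖ ^ 2) * ℓ w (‖t‖ ^ 2) =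
      (volume : Measure F).toSphere Set.univ * ∫⁻ u, g u * κ w u := by
    intro w
    have := lintegral_radial (F := F) hF (‖w - θ‖ ^ 2) (f := fun u v => g u * ℓ w v)
      (by
        have h2 : Measurable fun z : ℝ × ℝ => ℓ w z.2 :=
          hℓ.comp (measurable_const.prodMk measurable_snd)
        exact (hg.comp measurable_fst).mul h2)
    rw [this, hκ]
    congr 1
    refine lintegral_congr fun u => ?_
    ring
  have hgκ : Measurable (Function.uncurry fun (w : E) u => g u * κ w u) :=
    (hg.comp measurable_snd).mul hmeas
  -- Putting u outermost isolates `g u`, so inequalities can be proved for each u separately,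
  -- whatever the density.
  have hswap := lintegral_lintegral_swap (μ := (volume : Measure E)) (ν := (volume : Measure ℝ))
    hgκ.aemeasurable
  have h3 : ∀ u, ∫⁻ w : E, g u * κ w u = g u * ∫⁻ s : Metric.sphere (0 : E) 1,
      (∫⁻ r in Set.Ioi (0 : ℝ), ENNReal.ofReal (r ^ (q - 1)) * κ (r • (s : E)) u)
        ∂(volume : Measure E).toSphere := by
    intro u
    have hmu : Measurable fun w : E => κ w u := hmeas.comp (measurable_prodMk_right (y := u))
    rw [lintegral_const_mul _ hmu, lintegral_polar volume hmu, hE]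
  have hm1 : Measurable fun w : E => ∫⁻ u, g u * κ w u := hgκ.lintegral_prod_right'
  simp only [h1]
  rw [lintegral_const_mul _ hm1, hswap]
  simp only [h3]
  simp only [hκ]

/-- Stein's inequality for spherically symmetric distributions with residual vector. -/
theorem lintegral_stein_le [Nontrivial F] {q m : ℕ} (hq : 3 ≤ q) (hE : Module.finrank ℝ E = q)
    (hF : Module.finrank ℝ F = m) {g : ℝ → ℝ≥0∞} (hg : Measurable g) (θ : E)
    {k : ℝ} (hk : k = ((q : ℝ) - 2) / (m + 2)) :
    ∫⁻ w : E, ∫⁻ t : F, g (‖w - θ‖ ^ 2 + ‖t‖ ^ 2) *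
        ENNReal.ofReal (‖(1 - k * ‖t‖ ^ 2 / ‖w‖ ^ 2) • w - θ‖ ^ 2) ≤
      ∫⁻ w : E, ∫⁻ t : F, g (‖w - θ‖ ^ 2 + ‖t‖ ^ 2) * ENNReal.ofReal (‖w - θ‖ ^ 2) := by
  have hm : 1 ≤ m := by rw [← hF]; exact Module.finrank_pos
  have : Nontrivial E := Module.nontrivial_of_finrank_pos (R := ℝ) (by omega)
  have hL := lintegral_mixture hE hF hg θ
    (ℓ := fun w v => ENNReal.ofReal (‖(1 - k * v / ‖w‖ ^ 2) • w - θ‖ ^ 2)) (by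
    unfold Function.uncurry
    fun_prop)
  have hR := lintegral_mixture hE hF hg θ
    (ℓ := fun w v => ENNReal.ofReal (‖w - θ‖ ^ 2)) (by unfold Function.uncurry; fun_prop)
  rw [hL, hR]
  refine mul_le_mul' le_rfl (lintegral_mono fun u => mul_le_mul' le_rfl
    (lintegral_mono fun s => ?_))
  have hs1 : ‖(s : E)‖ = 1 := norm_eq_of_mem_sphere s
  set c : ℝ := inner ℝ (s : E) θ with hc
  have hcs : c ^ 2 ≤ ‖θ‖ ^ 2 := by
    have := abs_real_inner_le_norm (s : E) θ
    rw [hs1, one_mul] at this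
    exact sq_le_sq' (by linarith [neg_abs_le c]) ((le_abs_self _).trans this)
  have hb : ∀ r : ℝ, ‖r • (s : E) - θ‖ ^ 2 = r ^ 2 - 2 * c * r + ‖θ‖ ^ 2 := by
    intro r
    rw [norm_sub_sq_real, norm_smul, hs1, inner_smul_left, Real.norm_eq_abs, mul_one, sq_abs]
    simp [hc]; ring
  refine le_trans (le_of_eq ?_) (lintegral_stein_ray hq hm hcs u hk hb (fun r => rfl))
  refine setLIntegral_congr_fun measurableSet_Ioi fun r hr => ?_
  have hr0 : (0 : ℝ) < r := hr
  congr 1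
  -- Where the sphere of squared radius u does not reach the point of the ray, the weight is zero;
  -- elsewhere ‖t‖² is the square of the root.
  rcases le_or_gt (u - ‖r • (s : E) - θ‖ ^ 2) 0 with h | h
  · simp [Real.sqrt_eq_zero_of_nonpos h]
  · congr 2
    set v := u - ‖r • (s : E) - θ‖ ^ 2 with hv
    have h2 : Real.sqrt v ^ 2 = v := Real.sq_sqrt h.le
    have h4 : Real.sqrt v ^ 4 = v ^ 2 := by
      rw [show Real.sqrt v ^ 4 = (Real.sqrt v ^ 2) ^ 2 by ring, h2]
    rw [h2, h4, norm_smul, hs1, smul_smul, hb, hb, Real.norm_eq_abs, mul_one, sq_abs]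
    field_simp
    ring

end Radial

theorem measurePreserving_withDensity {α : Type*} [MeasurableSpace α] {μ : Measure α} {e : α → α}
    (he : MeasurePreserving e μ μ) {ρ : α → ℝ≥0∞} (hρ : Measurable ρ) (h : ∀ x, ρ (e x) = ρ x) :
    MeasurePreserving e (μ.withDensity ρ) (μ.withDensity ρ) := by
  refine ⟨he.measurable, Measure.ext fun s hs => ?_⟩
  rw [Measure.map_apply he.measurable hs, withDensity_apply _ (he.measurable hs),
    withDensity_apply _ hs, ← he.setLIntegral_comp_preimage hs hρ]
  simp only [h]

/-- Tonelli with the middle variable outermost. For a fixed nuisance component v the law of the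
other two is again spherical, with its density shifted by ‖v‖². -/
theorem lintegral_swap_middle {α β γ : Type*} [MeasurableSpace α] [MeasurableSpace β]
    [MeasurableSpace γ] (μ : Measure α) (ν : Measure β) (ρ : Measure γ) [SFinite μ] [SFinite ν]
    [SFinite ρ] {h : α × (β × γ) → ℝ≥0∞} (hh : Measurable h) :
    ∫⁻ a, ∫⁻ y, h (a, y) ∂(ν.prod ρ) ∂μ = ∫⁻ b, ∫⁻ a, ∫⁻ c, h (a, (b, c)) ∂ρ ∂μ ∂ν := by
  have h1 : ∀ a, ∫⁻ y, h (a, y) ∂(ν.prod ρ) = ∫⁻ b, ∫⁻ c, h (a, (b, c)) ∂ρ ∂ν := fun a =>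
    lintegral_prod _ (hh.comp measurable_prodMk_left).aemeasurable
  simp only [h1]
  have h2 : Measurable fun z : (α × β) × γ => h (z.1.1, (z.1.2, z.2)) := by fun_prop
  have h3 : Measurable (Function.uncurry fun a b => ∫⁻ c, h (a, (b, c)) ∂ρ) :=
    h2.lintegral_prod_right'
  exact lintegral_lintegral_swap h3.aemeasurable

/-! ### The canonical law: loss splitting, Stein estimation and the positive rule. -/

section Canonical

variable {E₁ E₂ E₃ G : Type*}
  [NormedAddCommGroup E₁] [InnerProductSpace ℝ E₁] [FiniteDimensional ℝ E₁]
  [MeasurableSpace E₁] [BorelSpace E₁]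
  [NormedAddCommGroup E₂] [InnerProductSpace ℝ E₂] [FiniteDimensional ℝ E₂]
  [MeasurableSpace E₂] [BorelSpace E₂]
  [NormedAddCommGroup E₃] [InnerProductSpace ℝ E₃] [FiniteDimensional ℝ E₃]
  [MeasurableSpace E₃] [BorelSpace E₃]
  [NormedAddCommGroup G] [InnerProductSpace ℝ G]

/-- The law with density `g (‖w - θ‖² + ‖v‖² + ‖t‖²)` at `(w, v, t)`. -/
def canonicalLaw (E₂ E₃ : Type*) [NormedAddCommGroup E₂] [InnerProductSpace ℝ E₂]
    [FiniteDimensional ℝ E₂] [MeasurableSpace E₂] [BorelSpace E₂]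
    [NormedAddCommGroup E₃] [InnerProductSpace ℝ E₃] [FiniteDimensional ℝ E₃]
    [MeasurableSpace E₃] [BorelSpace E₃] (g : ℝ → ℝ≥0∞) (θ : E₁) : Measure (E₁ × (E₂ × E₃)) :=
  ((volume : Measure E₁).prod ((volume : Measure E₂).prod (volume : Measure E₃))).withDensity
    fun z => g (‖z.1 - θ‖ ^ 2 + (‖z.2.1‖ ^ 2 + ‖z.2.2‖ ^ 2))

variable {g : ℝ → ℝ≥0∞} (hg : Measurable g) (θ : E₁)

include hg

theorem lintegral_canonicalLaw {f : E₁ × (E₂ × E₃) → ℝ≥0∞} (hf : Measurable f) :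
    ∫⁻ z, f z ∂(canonicalLaw E₂ E₃ g θ) = ∫⁻ w : E₁, ∫⁻ y : E₂ × E₃,
      g (‖w - θ‖ ^ 2 + (‖y.1‖ ^ 2 + ‖y.2‖ ^ 2)) * f (w, y)
        ∂((volume : Measure E₂).prod (volume : Measure E₃)) := by
  rw [canonicalLaw, lintegral_withDensity_eq_lintegral_mul _ (by fun_prop) hf, lintegral_prod]
  · rfl
  · exact ((by fun_prop : Measurable fun z : E₁ × (E₂ × E₃) =>
      g (‖z.1 - θ‖ ^ 2 + (‖z.2.1‖ ^ 2 + ‖z.2.2‖ ^ 2))).mul hf).aemeasurable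

theorem measurePreserving_canonicalLaw_neg :
    MeasurePreserving (fun z : E₁ × (E₂ × E₃) => (z.1, (-z.2.1, z.2.2)))
      (canonicalLaw E₂ E₃ g θ) (canonicalLaw E₂ E₃ g θ) := by
  refine measurePreserving_withDensity ?_ (by fun_prop) (fun z => by simp)
  exact (MeasurePreserving.id _).prod
    ((Measure.measurePreserving_neg (volume : Measure E₂)).prod (MeasurePreserving.id _))

/-- Isometries fixing θ do not change ‖w - θ‖. The one that matters is the reflection in the line
spanned by θ. -/
theorem measurePreserving_canonicalLaw_map (e : E₁ ≃ₗᵢ[ℝ] E₁) (he : e θ = θ) :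
    MeasurePreserving (fun z : E₁ × (E₂ × E₃) => (e z.1, z.2))
      (canonicalLaw E₂ E₃ g θ) (canonicalLaw E₂ E₃ g θ) := by
  refine measurePreserving_withDensity ?_ (by fun_prop) (fun z => ?_)
  · exact e.measurePreserving.prod (MeasurePreserving.id _)
  · have : ‖e z.1 - θ‖ = ‖z.1 - θ‖ := by
      conv_lhs => rw [← he, ← map_sub, e.norm_map]
    rw [this]

/-- The loss splits, since the cross term vanishes by the symmetry `v ↦ -v`. -/
theorem lintegral_loss_split (N₁ : E₁ →L[ℝ] G) (N₂ : E₂ →L[ℝ] G) {a : E₁ × (E₂ × E₃) → E₁}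
    (ha : Measurable a) (hsymm : ∀ w v t, a (w, (-v, t)) = a (w, (v, t))) :
    ∫⁻ z, ENNReal.ofReal (‖N₁ (a z) + N₂ z.2.1‖ ^ 2) ∂(canonicalLaw E₂ E₃ g θ) =
      ∫⁻ z, ENNReal.ofReal (‖N₁ (a z)‖ ^ 2) ∂(canonicalLaw E₂ E₃ g θ) +
        ∫⁻ z, ENNReal.ofReal (‖N₂ z.2.1‖ ^ 2) ∂(canonicalLaw E₂ E₃ g θ) := by
  borelize G
  set ν := canonicalLaw E₂ E₃ g θ
  have hN₁ : Measurable fun z => N₁ (a z) := N₁.continuous.measurable.comp ha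
  have hm : Measurable fun z : E₁ × (E₂ × E₃) => ENNReal.ofReal (‖N₁ (a z) + N₂ z.2.1‖ ^ 2) := by
    have : StronglyMeasurable fun z : E₁ × (E₂ × E₃) => N₁ (a z) + N₂ z.2.1 :=
      (N₁.continuous.comp_stronglyMeasurable ha.stronglyMeasurable).add
        ((N₂.continuous.comp (continuous_fst.comp continuous_snd)).stronglyMeasurable)
    exact ENNReal.measurable_ofReal.comp (this.norm.measurable.pow_const 2)
  have h1 : ∫⁻ z, ENNReal.ofReal (‖N₁ (a z) + N₂ z.2.1‖ ^ 2) ∂ν =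
      ∫⁻ z, ENNReal.ofReal (‖N₁ (a z) - N₂ z.2.1‖ ^ 2) ∂ν := by
    rw [← (measurePreserving_canonicalLaw_neg (E₂ := E₂) (E₃ := E₃) hg θ).lintegral_comp hm]
    refine lintegral_congr fun z => ?_
    rw [hsymm z.1 z.2.1 z.2.2, map_neg, ← sub_eq_add_neg]
  -- Averaging over the two signs of v and using the parallelogram law removes the cross term
  -- without any integrability assumption.
  have h2 : 2 * ∫⁻ z, ENNReal.ofReal (‖N₁ (a z) + N₂ z.2.1‖ ^ 2) ∂ν =
      2 * (∫⁻ z, ENNReal.ofReal (‖N₁ (a z)‖ ^ 2) ∂ν +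
        ∫⁻ z, ENNReal.ofReal (‖N₂ z.2.1‖ ^ 2) ∂ν) := by
    conv_lhs => rw [two_mul]
    nth_rewrite 2 [h1]
    rw [← lintegral_add_left hm, ← lintegral_add_left (by fun_prop),
      ← lintegral_const_mul _ (by fun_prop)]
    refine lintegral_congr fun z => ?_
    rw [← ENNReal.ofReal_add (by positivity) (by positivity),
      ← ENNReal.ofReal_add (by positivity) (by positivity),
      show (2 : ℝ≥0∞) = ENNReal.ofReal 2 by simp, ← ENNReal.ofReal_mul zero_le_two]
    congr 1
    have := parallelogram_law_with_norm ℝ (N₁ (a z)) (N₂ z.2.1)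
    nlinarith
  exact (ENNReal.mul_right_inj two_ne_zero ENNReal.ofNat_ne_top).1 h2

/-- Stein's inequality under the canonical law. -/
theorem lintegral_canonicalLaw_stein_le [Nontrivial E₃] {q m : ℕ} (hq : 3 ≤ q)
    (hE : Module.finrank ℝ E₁ = q) (hF : Module.finrank ℝ E₃ = m) {k : ℝ}
    (hk : k = ((q : ℝ) - 2) / (m + 2)) :
    ∫⁻ z, ENNReal.ofReal (‖(1 - k * ‖z.2.2‖ ^ 2 / ‖z.1‖ ^ 2) • z.1 - θ‖ ^ 2)
        ∂(canonicalLaw E₂ E₃ g θ) ≤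
      ∫⁻ z, ENNReal.ofReal (‖z.1 - θ‖ ^ 2) ∂(canonicalLaw E₂ E₃ g θ) := by
  have key : ∀ f : E₁ → E₃ → ℝ≥0∞, Measurable (Function.uncurry f) →
      ∫⁻ z, f z.1 z.2.2 ∂(canonicalLaw E₂ E₃ g θ) = ∫⁻ v : E₂, ∫⁻ w : E₁, ∫⁻ t : E₃,
        g (‖w - θ‖ ^ 2 + ‖t‖ ^ 2 + ‖v‖ ^ 2) * f w t := by
    intro f hf
    have hf1 : Measurable fun z : E₁ × (E₂ × E₃) => f z.1 z.2.2 :=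
      hf.comp (measurable_fst.prodMk (measurable_snd.comp measurable_snd))
    have hf2 : Measurable fun z : E₁ × (E₂ × E₃) =>
        g (‖z.1 - θ‖ ^ 2 + (‖z.2.1‖ ^ 2 + ‖z.2.2‖ ^ 2)) * f z.1 z.2.2 :=
      (by fun_prop : Measurable fun z : E₁ × (E₂ × E₃) =>
        g (‖z.1 - θ‖ ^ 2 + (‖z.2.1‖ ^ 2 + ‖z.2.2‖ ^ 2))).mul hf1
    rw [lintegral_canonicalLaw hg θ hf1]
    refine (lintegral_swap_middle volume volume volume hf2).trans ?_
    refine lintegral_congr fun v => lintegral_congr fun w => lintegral_congr fun t => ?_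
    rw [add_comm (‖v‖ ^ 2), add_assoc]
  have hL := key (fun w t => ENNReal.ofReal (‖(1 - k * ‖t‖ ^ 2 / ‖w‖ ^ 2) • w - θ‖ ^ 2)) (by
    unfold Function.uncurry; fun_prop)
  have hR := key (fun w t => ENNReal.ofReal (‖w - θ‖ ^ 2)) (by
    unfold Function.uncurry; fun_prop)
  rw [hL, hR]
  refine lintegral_mono fun v => ?_
  exact lintegral_stein_le (g := fun u => g (u + ‖v‖ ^ 2)) hq hE hF (by fun_prop) θ hk

/-- The excess shrinkage factor, which is positive where the Stein-type estimator overshoots. -/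
theorem integral_inner_excess_nonneg (hdim : 2 ≤ Module.finrank ℝ (E₂ × E₃)) {k : ℝ} (hk : 0 ≤ k)
    (hint : Integrable (fun z : E₁ × (E₂ × E₃) => max 0 (k * ‖z.2.2‖ ^ 2 / ‖z.1‖ ^ 2 - 1) • z.1)
      (canonicalLaw E₂ E₃ g θ)) :
    0 ≤ ∫ z, inner ℝ (max 0 (k * ‖z.2.2‖ ^ 2 / ‖z.1‖ ^ 2 - 1) • z.1) θ
      ∂(canonicalLaw E₂ E₃ g θ) := by
  have hint' := hint.inner_const (𝕜 := ℝ) θ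
  rw [integral_eq_lintegral_pos_part_sub_lintegral_neg_part hint', sub_nonneg]
  refine ENNReal.toReal_mono ?_ ?_
  · exact (lt_of_le_of_lt (lintegral_mono fun z => Real.ofReal_le_enorm _) hint'.2).ne
  have hneg : ∀ w : E₁, (fun z : E₁ × (E₂ × E₃) => -inner ℝ
      (max 0 (k * ‖z.2.2‖ ^ 2 / ‖z.1‖ ^ 2 - 1) • z.1) θ) = fun z => inner ℝ
      (max 0 (k * ‖z.2.2‖ ^ 2 / ‖z.1‖ ^ 2 - 1) • (-z.1)) θ := by
    intro w; ext z; simp [inner_smul_left, inner_neg_left]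
  have hmeas : Measurable fun z : E₁ × (E₂ × E₃) => ENNReal.ofReal
      (inner ℝ (max 0 (k * ‖z.2.2‖ ^ 2 / ‖z.1‖ ^ 2 - 1) • z.1) θ) := by fun_prop
  have hmeas' : Measurable fun z : E₁ × (E₂ × E₃) => ENNReal.ofReal
      (-inner ℝ (max 0 (k * ‖z.2.2‖ ^ 2 / ‖z.1‖ ^ 2 - 1) • z.1) θ) := by fun_prop
  -- The negative part is evaluated at -w, so that it can be compared with the positive part at w
  -- for each w separately.
  rw [lintegral_canonicalLaw hg θ hmeas', lintegral_canonicalLaw hg θ hmeas,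
    ← lintegral_neg_eq_self]
  refine lintegral_mono fun w => ?_
  rcases le_or_gt (inner ℝ w θ) 0 with h | h
  · refine le_of_eq_of_le (lintegral_eq_zero_of_ae_eq_zero (ae_of_all _ fun y => ?_)) zero_le
    have h1 : inner ℝ (max 0 (k * ‖y.2‖ ^ 2 / ‖w‖ ^ 2 - 1) • w) θ ≤ 0 := by
      rw [inner_smul_left]
      exact mul_nonpos_of_nonneg_of_nonpos (le_max_left _ _) h
    simp only [norm_neg, smul_neg, inner_neg_left, neg_neg, ENNReal.ofReal_of_nonpos h1, mul_zero,
      Pi.zero_apply]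
  -- When ⟨w, θ⟩ > 0 the point w is nearer to θ than -w is, and the excess factor increases along
  -- rays in (v, t), so the translation inequality applies.
  · have hab : ‖w - θ‖ ^ 2 ≤ ‖-w - θ‖ ^ 2 := by
      rw [norm_sub_sq_real, norm_sub_sq_real, inner_neg_left, norm_neg]; linarith
    refine le_trans (le_of_eq ?_) (lintegral_translate_mono
      ((volume : Measure E₂).prod (volume : Measure E₃)) hdim hab hg
      (Q := fun y => ‖y.1‖ ^ 2 + ‖y.2‖ ^ 2) (by fun_prop) ?_ ?_
      (Φ := fun y => ENNReal.ofReal (inner ℝ (max 0 (k * ‖y.2‖ ^ 2 / ‖w‖ ^ 2 - 1) • w) θ))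
      (by fun_prop) ?_)
    · simp only [norm_neg, smul_neg, inner_neg_left, neg_neg]
    · intro r y
      simp [norm_smul, mul_pow]; ring
    · rintro ⟨y₁, y₂⟩ hy
      by_cases h1 : y₁ = 0
      · have h2 : y₂ ≠ 0 := fun h2 => hy (by simp [h1, h2])
        have := norm_pos_iff.2 h2
        positivity
      · have := norm_pos_iff.2 h1
        positivity
    · intro y r hr
      refine ENNReal.ofReal_le_ofReal ?_
      rw [inner_smul_left, inner_smul_left]
      refine mul_le_mul_of_nonneg_right ?_ h.le
      have : ‖y.2‖ ≤ ‖(r • y).2‖ := by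
        rw [Prod.smul_snd, norm_smul, Real.norm_eq_abs]
        exact le_mul_of_one_le_left (norm_nonneg _) (hr.trans (le_abs_self r))
      simp only [conj_trivial]
      gcongr

/-- Replacing negative shrinkage factors by zero does not increase the risk. -/
theorem lintegral_positivePart_le [IsFiniteMeasure (canonicalLaw E₂ E₃ g θ)]
    (hdim : 2 ≤ Module.finrank ℝ (E₂ × E₃)) {k : ℝ} (hk : 0 ≤ k)
    (hfin : ∫⁻ z, ENNReal.ofReal (‖(1 - k * ‖z.2.2‖ ^ 2 / ‖z.1‖ ^ 2) • z.1 - θ‖ ^ 2)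
        ∂(canonicalLaw E₂ E₃ g θ) < ⊤) (N₁ : E₁ →L[ℝ] G) :
    ∫⁻ z, ENNReal.ofReal (‖N₁ (max 0 (1 - k * ‖z.2.2‖ ^ 2 / ‖z.1‖ ^ 2) • z.1 - θ)‖ ^ 2)
        ∂(canonicalLaw E₂ E₃ g θ) ≤
      ∫⁻ z, ENNReal.ofReal (‖N₁ ((1 - k * ‖z.2.2‖ ^ 2 / ‖z.1‖ ^ 2) • z.1 - θ)‖ ^ 2)
        ∂(canonicalLaw E₂ E₃ g θ) := by
  have hexc := integral_inner_excess_nonneg (E₂ := E₂) (E₃ := E₃) hg θ hdim hk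
  set ν := canonicalLaw E₂ E₃ g θ with hν
  set a : E₁ × (E₂ × E₃) → ℝ := fun z => 1 - k * ‖z.2.2‖ ^ 2 / ‖z.1‖ ^ 2 with ha
  -- `χ` is the negative part of the Stein factor `a`: the positive-rule factor is `a + χ`, and its
  -- product with `χ` is zero.
  set χ : E₁ × (E₂ × E₃) → ℝ := fun z => max 0 (k * ‖z.2.2‖ ^ 2 / ‖z.1‖ ^ 2 - 1) with hχ
  have ham : Measurable a := by fun_prop
  have hχm : Measurable χ := by fun_prop
  have hχa : ∀ z, max 0 (a z) = a z + χ z := fun z => by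
    simp only [ha, hχ]
    rcases le_total (k * ‖z.2.2‖ ^ 2 / ‖z.1‖ ^ 2) 1 with h | h
    · rw [max_eq_right (by linarith), max_eq_left (by linarith)]; ring
    · rw [max_eq_left (by linarith), max_eq_right (by linarith)]; ring
  have hχ0 : ∀ z, 0 ≤ χ z := fun z => le_max_left _ _
  have hmul : ∀ z, max 0 (a z) * χ z = 0 := fun z => by
    simp only [ha, hχ]
    rcases le_total (k * ‖z.2.2‖ ^ 2 / ‖z.1‖ ^ 2) 1 with h | h
    · rw [max_eq_left (b := k * ‖z.2.2‖ ^ 2 / ‖z.1‖ ^ 2 - 1) (by linarith), mul_zero]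
    · rw [max_eq_left (by linarith), zero_mul]
  have haL : MemLp (fun z => a z • z.1 - θ) 2 ν := by
    rw [memLp_two_iff_integrable_sq_norm (by fun_prop)]
    refine ⟨by fun_prop, ?_⟩
    rwa [hasFiniteIntegral_iff_ofReal (ae_of_all _ fun z => by positivity)]
  have haL' : MemLp (fun z => a z • z.1) 2 ν := by
    have h := haL.add (memLp_const θ)
    have e : ((fun z => a z • z.1 - θ) + fun _ => θ) = fun z => a z • z.1 := by
      ext z; simp
    rwa [e] at h
  have habs : ∀ z, |max 0 (a z)| ≤ |a z| := fun z => by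
    rw [abs_of_nonneg (le_max_left _ _)]
    exact max_le (abs_nonneg _) (le_abs_self _)
  have habs' : ∀ z, |χ z| ≤ |a z| := fun z => by
    rw [abs_of_nonneg (hχ0 z)]
    refine max_le (abs_nonneg _) ?_
    have := neg_le_abs (a z)
    simp only [ha] at this ⊢
    linarith
  have hfL : MemLp (fun z => max 0 (a z) • z.1) 2 ν := by
    refine haL'.of_le (by fun_prop) (ae_of_all _ fun z => ?_)
    rw [norm_smul, norm_smul]
    exact mul_le_mul_of_nonneg_right (habs z) (norm_nonneg _)
  have hχL : MemLp (fun z => χ z • z.1) 2 ν := by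
    refine haL'.of_le (by fun_prop) (ae_of_all _ fun z => ?_)
    rw [norm_smul, norm_smul]
    exact mul_le_mul_of_nonneg_right (habs' z) (norm_nonneg _)
  have hχi : Integrable (fun z => χ z • z.1) ν := hχL.integrable one_le_two
  have hi1 : Integrable (fun z => ‖N₁ (max 0 (a z) • z.1 - θ)‖ ^ 2) ν :=
    (N₁.comp_memLp' (hfL.sub (memLp_const θ))).integrable_norm_pow two_ne_zero
  have hi2 : Integrable (fun z => ‖N₁ (a z • z.1 - θ)‖ ^ 2) ν :=
    (N₁.comp_memLp' haL).integrable_norm_pow two_ne_zero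
  have hi3 : Integrable (fun z => inner ℝ (N₁ (χ z • z.1)) (N₁ θ)) ν :=
    (N₁.integrable_comp hχi).inner_const _
  rw [← ofReal_integral_eq_lintegral_ofReal hi1 (ae_of_all _ fun z => by positivity),
    ← ofReal_integral_eq_lintegral_ofReal hi2 (ae_of_all _ fun z => by positivity)]
  refine ENNReal.ofReal_le_ofReal ?_
  -- Since the positive-rule factor annihilates `χ`, only θ survives in the cross term; the dropped
  -- term is ‖χ N₁ w‖².
  have hpt : ∀ z, ‖N₁ (max 0 (a z) • z.1 - θ)‖ ^ 2 + 2 * inner ℝ (N₁ (χ z • z.1)) (N₁ θ) ≤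
      ‖N₁ (a z • z.1 - θ)‖ ^ 2 := by
    intro z
    have e : a z • z.1 - θ = (max 0 (a z) • z.1 - θ) - χ z • z.1 := by
      rw [hχa, add_smul]; abel
    rw [e, map_sub _ (max 0 (a z) • z.1 - θ), norm_sub_sq_real (N₁ (max 0 (a z) • z.1 - θ)),
      map_sub, inner_sub_left, map_smul, map_smul, inner_smul_left, inner_smul_right,
      inner_smul_right, real_inner_comm (N₁ z.1) (N₁ θ)]
    have h1 : χ z * (max 0 (a z) * inner ℝ (N₁ z.1) (N₁ z.1)) = 0 := by
      rw [← mul_assoc, mul_comm (χ z), hmul, zero_mul]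
    simp only [conj_trivial] at h1 ⊢
    rw [inner_smul_left]
    simp only [conj_trivial] at h1 ⊢
    nlinarith [sq_nonneg ‖χ z • N₁ z.1‖]
  have hle := integral_mono (hi1.add (hi3.const_mul 2)) hi2 hpt
  rw [integral_add' hi1 (hi3.const_mul 2), integral_const_mul] at hle
  suffices 0 ≤ ∫ z, inner ℝ (N₁ (χ z • z.1)) (N₁ θ) ∂ν by linarith
  set M : E₁ := ∫ z, χ z • z.1 ∂ν with hM
  have hNM : ∫ z, inner ℝ (N₁ (χ z • z.1)) (N₁ θ) ∂ν = inner ℝ (N₁ M) (N₁ θ) := by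
    have := ((innerSL ℝ (N₁ θ)).comp N₁).integral_comp_comm hχi
    simpa only [ContinuousLinearMap.comp_apply, innerSL_apply_apply, real_inner_comm] using this
  have hMθ : 0 ≤ inner ℝ M θ := by
    rw [real_inner_comm, hM, ← integral_inner hχi]
    simpa only [real_inner_comm] using hexc hχi
  -- Invariance under the reflection forces M = cθ. Hence ⟨N₁M, N₁θ⟩ = c‖N₁θ‖² has the sign of c for
  -- any `N₁`, and that sign is read off from ⟨M, θ⟩ ≥ 0.
  have hrefl : (ℝ ∙ θ).reflection M = M := by
    set e : E₁ ≃ₗᵢ[ℝ] E₁ := (ℝ ∙ θ).reflection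
    have he : e θ = θ := (Submodule.reflection_eq_self_iff θ).2 (Submodule.mem_span_singleton_self θ)
    have hmp := measurePreserving_canonicalLaw_map (E₂ := E₂) (E₃ := E₃) hg θ e he
    calc e M = ∫ z, e (χ z • z.1) ∂ν :=
          (e.toContinuousLinearEquiv.toContinuousLinearMap.integral_comp_comm hχi).symm
      _ = ∫ z, χ (e z.1, z.2) • e z.1 ∂ν := by simp [hχ]
      _ = ∫ z, χ z • z.1 ∂(ν.map fun z => (e z.1, z.2)) :=
          (integral_map (f := fun z => χ z • z.1) hmp.measurable.aemeasurable
            (Measurable.aestronglyMeasurable (by fun_prop))).symm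
      _ = M := by rw [hmp.map_eq]
  obtain ⟨c, hc⟩ := Submodule.mem_span_singleton.1 ((Submodule.reflection_eq_self_iff M).1 hrefl)
  rw [hNM, ← hc, map_smul, inner_smul_left, real_inner_self_eq_norm_sq]
  rw [← hc, inner_smul_left, real_inner_self_eq_norm_sq] at hMθ
  by_cases hθ : θ = 0
  · simp [hθ]
  · have : 0 < ‖θ‖ ^ 2 := by have := norm_pos_iff.2 hθ; positivity
    have hc0 : 0 ≤ c := by simpa using nonneg_of_mul_nonneg_left hMθ this
    simp only [conj_trivial]
    positivity

end Canonical

/-! ### Separation of density and integrand for homogeneous functions. -/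

section Homogeneous

variable {E : Type*} [NormedAddCommGroup E] [NormedSpace ℝ E] [FiniteDimensional ℝ E]
  [MeasurableSpace E] [BorelSpace E]

theorem lintegral_Ioi_comp_mul {c : ℝ} (hc : 0 < c) (f : ℝ → ℝ≥0∞) :
    ∫⁻ r in Set.Ioi (0 : ℝ), f r = ∫⁻ r in Set.Ioi (0 : ℝ), ENNReal.ofReal c * f (c * r) := by
  have himg : (fun r => c * r) '' Set.Ioi (0 : ℝ) = Set.Ioi 0 := by
    simpa using Set.image_const_mul_Ioi_zero hc
  have h := lintegral_image_eq_lintegral_abs_deriv_mul (s := Set.Ioi (0 : ℝ)) measurableSet_Ioi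
    (f := fun r => c * r) (f' := fun _ => c)
    (fun x _ => ((hasDerivAt_id x).const_mul c |>.congr_deriv (mul_one c)).hasDerivWithinAt)
    ((mul_right_injective₀ hc.ne').injOn) f
  rw [himg] at h
  rw [h, abs_of_pos hc]

/-- The integral of a homogeneous function of degree two against a density depending on a
quadratic gauge factors into a part depending on the density and a part depending on the
function. -/
theorem lintegral_homogeneous [Nontrivial E] (μ : Measure E) [μ.IsAddHaarMeasure]
    {Q : E → ℝ} (hQm : Measurable Q) (hQ : ∀ (r : ℝ) (y : E), Q (r • y) = r ^ 2 * Q y)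
    (hQ0 : ∀ y, y ≠ 0 → 0 < Q y) {Ψ : E → ℝ≥0∞} (hΨm : Measurable Ψ)
    (hΨ : ∀ (y : E) (r : ℝ), 0 < r → Ψ (r • y) = ENNReal.ofReal (r ^ 2) * Ψ y) :
    ∃ B : ℝ≥0∞, ∀ g : ℝ → ℝ≥0∞, Measurable g → ∫⁻ y, g (Q y) * Ψ y ∂μ =
      (∫⁻ r in Set.Ioi (0 : ℝ), ENNReal.ofReal (r ^ (Module.finrank ℝ E + 2 - 1)) * g (r ^ 2)) *
        B := by
  refine ⟨∫⁻ s : Metric.sphere (0 : E) 1, ENNReal.ofReal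
    ((Real.sqrt (Q s))⁻¹ ^ (Module.finrank ℝ E + 2)) * Ψ s ∂μ.toSphere, fun g hg => ?_⟩
  have hN : 0 < Module.finrank ℝ E := Module.finrank_pos
  obtain ⟨N, hN'⟩ := Nat.exists_eq_add_of_lt hN
  rw [zero_add] at hN'
  rw [lintegral_polar μ (by fun_prop), hN', ← lintegral_const_mul _ (by fun_prop)]
  refine lintegral_congr fun s => ?_
  have hs : (s : E) ≠ 0 := ne_zero_of_mem_unit_sphere s
  have hq := Real.sqrt_pos.2 (hQ0 _ hs)
  have hsq := Real.sq_sqrt (hQ0 _ hs).le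
  -- Rescaling the ray through s by c makes the gauge equal to r², so the radial integral no longer
  -- depends on the direction. The Jacobian, polar weight and degree two together produce c to the
  -- power dimension + 2.
  set c := (Real.sqrt (Q s))⁻¹ with hc
  have hc0 : 0 < c := inv_pos.2 hq
  have hcQ : c ^ 2 * Q s = 1 := by rw [hc, inv_pow, hsq, inv_mul_cancel₀ (hQ0 _ hs).ne']
  rw [lintegral_Ioi_comp_mul hc0, ← lintegral_mul_const _ (by fun_prop)]
  refine setLIntegral_congr_fun measurableSet_Ioi fun r hr => ?_
  have hr0 : (0 : ℝ) < r := hr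
  have e1 : (c * r) ^ 2 * Q s = r ^ 2 := by rw [mul_pow, mul_right_comm, hcQ, one_mul]
  simp only [hQ, hΨ _ _ (mul_pos hc0 hr0), e1]
  have e2 : ENNReal.ofReal c * (ENNReal.ofReal ((c * r) ^ (N + 1 - 1)) *
      (g (r ^ 2) * (ENNReal.ofReal ((c * r) ^ 2) * Ψ s))) =
      ENNReal.ofReal (c * ((c * r) ^ (N + 1 - 1) * (c * r) ^ 2)) * g (r ^ 2) * Ψ s := by
    rw [ENNReal.ofReal_mul hc0.le, ENNReal.ofReal_mul (p := (c * r) ^ (N + 1 - 1)) (by positivity)]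
    ring
  have e3 : ENNReal.ofReal (r ^ (N + 1 + 2 - 1)) * g (r ^ 2) *
      (ENNReal.ofReal (c ^ (N + 1 + 2)) * Ψ s) =
      ENNReal.ofReal (r ^ (N + 1 + 2 - 1) * c ^ (N + 1 + 2)) * g (r ^ 2) * Ψ s := by
    rw [ENNReal.ofReal_mul (by positivity)]
    ring
  rw [e2, e3, show N + 1 - 1 = N by omega, show N + 1 + 2 - 1 = N + 2 by omega]
  congr 3
  ring

end Homogeneous

/-! ### Gaussian radii and chi-square laws. -/

section Gamma

theorem lintegral_gammaMeasure {a r : ℝ} {f : ℝ → ℝ≥0∞} (hf : Measurable f) :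
    ∫⁻ x, f x ∂(gammaMeasure a r) = ∫⁻ x in Set.Ioi (0 : ℝ),
      ENNReal.ofReal (r ^ a / Real.Gamma a * x ^ (a - 1) * Real.exp (-(r * x))) * f x := by
  rw [gammaMeasure, lintegral_withDensity_eq_lintegral_mul _ (by
    unfold gammaPDF; fun_prop) hf, ← lintegral_add_compl _ (measurableSet_Ioi (a := (0 : ℝ)))]
  have h0 : ∫⁻ x in (Set.Ioi (0 : ℝ))ᶜ, (gammaPDF a r * f) x = 0 := by
    rw [Set.compl_Ioi, setLIntegral_congr Iio_ae_eq_Iic.symm]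
    refine (setLIntegral_congr_fun measurableSet_Iio fun x hx => ?_).trans lintegral_zero
    simp [gammaPDF_of_neg hx]
  rw [h0, add_zero]
  refine setLIntegral_congr_fun measurableSet_Ioi fun x hx => ?_
  have hx0 : (0 : ℝ) < x := hx
  simp [gammaPDF_of_nonneg hx0.le]

/-- The squared radius of a Gaussian vector has a chi-square distribution. -/
theorem lintegral_gaussian_radius {k : ℕ} (hk : 0 < k) :
    ∃ K : ℝ≥0∞, K ≠ 0 ∧ K ≠ ⊤ ∧ ∀ f : ℝ → ℝ≥0∞, Measurable f →
      ∫⁻ r in Set.Ioi (0 : ℝ), ENNReal.ofReal (r ^ (k - 1)) *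
        (ENNReal.ofReal (Real.exp (-(r ^ 2 / 2))) * f (r ^ 2)) =
      K * ∫⁻ x, f x ∂(gammaMeasure ((k : ℝ) / 2) (1 / 2)) := by
  have hk0 : (0 : ℝ) < k := by exact_mod_cast hk
  -- The normalising constant of the chi-square density, with a factor 2 from dx = 2r dr in x = r².
  set C : ℝ := 2 * ((1 / 2 : ℝ) ^ ((k : ℝ) / 2) / Real.Gamma ((k : ℝ) / 2)) with hC
  have hC0 : 0 < C := by
    have := Real.Gamma_pos_of_pos (show 0 < (k : ℝ) / 2 by positivity)
    positivity
  have hCne : ENNReal.ofReal C ≠ 0 := by simpa using hC0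
  refine ⟨(ENNReal.ofReal C)⁻¹, ENNReal.inv_ne_zero.2 ENNReal.ofReal_ne_top,
    ENNReal.inv_ne_top.2 hCne, fun f hf => ?_⟩
  rw [← ENNReal.mul_right_inj hCne ENNReal.ofReal_ne_top, ← mul_assoc (ENNReal.ofReal C),
    ENNReal.mul_inv_cancel hCne ENNReal.ofReal_ne_top, one_mul, lintegral_gammaMeasure hf]
  have himg : (fun r : ℝ => r ^ 2) '' Set.Ioi (0 : ℝ) = Set.Ioi 0 := by
    ext x
    constructor
    · rintro ⟨r, hr, rfl⟩
      have hr0 : (0 : ℝ) < r := hr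
      exact pow_pos hr0 2
    · intro hx
      exact ⟨Real.sqrt x, Real.sqrt_pos.2 hx, Real.sq_sqrt (le_of_lt hx)⟩
  have h := lintegral_image_eq_lintegral_abs_deriv_mul (s := Set.Ioi (0 : ℝ)) measurableSet_Ioi
    (f := fun r : ℝ => r ^ 2) (f' := fun r => 2 * r)
    (fun x _ => by simpa using (hasDerivAt_pow 2 x).hasDerivWithinAt)
    (fun x hx y hy hxy => (sq_eq_sq₀ (le_of_lt hx) (le_of_lt hy)).1 hxy)
    (fun x => ENNReal.ofReal ((1 / 2 : ℝ) ^ ((k : ℝ) / 2) / Real.Gamma ((k : ℝ) / 2) *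
      x ^ ((k : ℝ) / 2 - 1) * Real.exp (-(1 / 2 * x))) * f x)
  rw [himg] at h
  rw [h, ← lintegral_const_mul _ (by fun_prop)]
  refine setLIntegral_congr_fun measurableSet_Ioi fun r hr => ?_
  have hr0 : (0 : ℝ) < r := hr
  have hpow : (r ^ 2) ^ ((k : ℝ) / 2 - 1) * r = r ^ (k - 1) := by
    rw [← Real.rpow_natCast r 2, ← Real.rpow_mul hr0.le, ← Real.rpow_add_one hr0.ne',
      ← Real.rpow_natCast]
    congr 1
    push_cast [hk]
    ring
  simp only [abs_of_pos (show 0 < 2 * r by positivity)]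
  rw [← mul_assoc, ← mul_assoc, ← mul_assoc, ← ENNReal.ofReal_mul hC0.le,
    ← ENNReal.ofReal_mul (by positivity), ← ENNReal.ofReal_mul (by positivity)]
  congr 2
  rw [← hpow, hC, show r ^ 2 / 2 = 1 / 2 * r ^ 2 by ring]
  ring

end Gamma

/-! ### Reduction of the null risks to an F-distribution. -/

section Null

variable {E₁ E₂ E₃ : Type*}
  [NormedAddCommGroup E₁] [InnerProductSpace ℝ E₁] [FiniteDimensional ℝ E₁]
  [MeasurableSpace E₁] [BorelSpace E₁]
  [NormedAddCommGroup E₂] [InnerProductSpace ℝ E₂] [FiniteDimensional ℝ E₂]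
  [MeasurableSpace E₂] [BorelSpace E₂]
  [NormedAddCommGroup E₃] [InnerProductSpace ℝ E₃] [FiniteDimensional ℝ E₃]
  [MeasurableSpace E₃] [BorelSpace E₃]

theorem lintegral_fDist {a b : ℕ} {f : ℝ → ℝ≥0∞} (hf : Measurable f) :
    ∫⁻ x, f x ∂(fDist a b) = ∫⁻ x, ∫⁻ y, f ((x / a) / (y / b))
      ∂(gammaMeasure ((b : ℝ) / 2) (1 / 2)) ∂(gammaMeasure ((a : ℝ) / 2) (1 / 2)) := by
  have hm : Measurable fun z : ℝ × ℝ => (z.1 / a) / (z.2 / b) := by fun_prop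
  have : SFinite (gammaMeasure ((b : ℝ) / 2) (1 / 2)) := by unfold gammaMeasure; infer_instance
  rw [fDist, lintegral_map hf hm]
  exact lintegral_prod (fun z : ℝ × ℝ => f ((z.1 / a) / (z.2 / b))) (hf.comp hm).aemeasurable

/-- The Gaussian case: under the law weighted by a quadratic function of the first component, the
test statistic is a multiple of an `F`-variable. -/
theorem lintegral_gaussian_ratio [Nontrivial E₁] [Nontrivial E₃] {q m : ℕ}
    (hE : Module.finrank ℝ E₁ = q) (hF : Module.finrank ℝ E₃ = m) {A : E₁ → ℝ≥0∞}
    (hA : Measurable A) (hA2 : ∀ (y : E₁) (r : ℝ), 0 < r → A (r • y) = ENNReal.ofReal (r ^ 2) * A y) :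
    ∃ K : ℝ≥0∞, ∀ ψ : ℝ → ℝ≥0∞, Measurable ψ →
      ∫⁻ w : E₁, ∫⁻ t : E₃, ENNReal.ofReal (Real.exp (-(‖w‖ ^ 2 / 2))) *
        ENNReal.ofReal (Real.exp (-(‖t‖ ^ 2 / 2))) * (A w * ψ (‖w‖ ^ 2 / (q * (‖t‖ ^ 2 / m)))) =
      K * ∫⁻ x, ψ (((q : ℝ) + 2) / q * x) ∂(fDist (q + 2) m) := by
  have hm : 0 < m := by rw [← hF]; exact Module.finrank_pos
  have hq : 0 < q := by rw [← hE]; exact Module.finrank_pos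
  have hq0 : (0 : ℝ) < q := by exact_mod_cast hq
  -- The degree-two weight `A` contributes r² along each ray and raises r^(q-1) to r^(q+1), the
  -- radial weight of dimension q + 2.
  obtain ⟨K₁, -, -, hK₁⟩ := lintegral_gaussian_radius (k := q + 2) (by omega)
  obtain ⟨K₃, -, -, hK₃⟩ := lintegral_gaussian_radius hm
  have hsf : SFinite (gammaMeasure ((m : ℝ) / 2) (1 / 2)) := by unfold gammaMeasure; infer_instance
  refine ⟨(volume : Measure E₃).toSphere Set.univ * K₃ *
    ((∫⁻ s : Metric.sphere (0 : E₁) 1, A s ∂(volume : Measure E₁).toSphere) * K₁), fun ψ hψ => ?_⟩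
  set h : ℝ → ℝ≥0∞ := fun a => ∫⁻ b, ψ (a / (q * (b / m))) ∂gammaMeasure ((m : ℝ) / 2) (1 / 2)
    with hh
  have hhm : Measurable h := by
    have : Measurable fun z : ℝ × ℝ => ψ (z.1 / (q * (z.2 / m))) := hψ.comp (by fun_prop)
    exact this.lintegral_prod_right'
  have h1 : ∀ w : E₁, ∫⁻ t : E₃, ENNReal.ofReal (Real.exp (-(‖w‖ ^ 2 / 2))) *
        ENNReal.ofReal (Real.exp (-(‖t‖ ^ 2 / 2))) * (A w * ψ (‖w‖ ^ 2 / (q * (‖t‖ ^ 2 / m)))) =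
      (volume : Measure E₃).toSphere Set.univ * K₃ *
        (ENNReal.ofReal (Real.exp (-(‖w‖ ^ 2 / 2))) * A w * h (‖w‖ ^ 2)) := by
    intro w
    have e : ∫⁻ t : E₃, ENNReal.ofReal (Real.exp (-(‖t‖ ^ 2 / 2))) *
        ψ (‖w‖ ^ 2 / (q * (‖t‖ ^ 2 / m))) =
        (volume : Measure E₃).toSphere Set.univ * K₃ * h (‖w‖ ^ 2) := by
      rw [lintegral_polar volume (by fun_prop), hF]
      have : ∀ s : Metric.sphere (0 : E₃) 1, ∫⁻ r in Set.Ioi (0 : ℝ), ENNReal.ofReal (r ^ (m - 1)) *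
          (ENNReal.ofReal (Real.exp (-(‖r • (s : E₃)‖ ^ 2 / 2))) *
            ψ (‖w‖ ^ 2 / (q * (‖r • (s : E₃)‖ ^ 2 / m)))) = K₃ * h (‖w‖ ^ 2) := by
        intro s
        have := hK₃ (fun b => ψ (‖w‖ ^ 2 / (q * (b / m)))) (by fun_prop)
        rw [hh, ← this]
        refine lintegral_congr fun r => ?_
        rw [norm_smul, norm_eq_of_mem_sphere, mul_one, Real.norm_eq_abs, sq_abs]
      simp only [this, lintegral_const]
      ring
    have e' : ∀ t : E₃, ENNReal.ofReal (Real.exp (-(‖w‖ ^ 2 / 2))) *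
        ENNReal.ofReal (Real.exp (-(‖t‖ ^ 2 / 2))) * (A w * ψ (‖w‖ ^ 2 / (q * (‖t‖ ^ 2 / m)))) =
        (ENNReal.ofReal (Real.exp (-(‖w‖ ^ 2 / 2))) * A w) *
        (ENNReal.ofReal (Real.exp (-(‖t‖ ^ 2 / 2))) * ψ (‖w‖ ^ 2 / (q * (‖t‖ ^ 2 / m)))) :=
      fun t => by ring
    simp only [e']
    rw [lintegral_const_mul _ (by fun_prop), e]
    ring
  simp only [h1]
  rw [lintegral_const_mul _ (by fun_prop), lintegral_polar volume (by fun_prop), hE]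
  have h2 : ∀ s : Metric.sphere (0 : E₁) 1, ∫⁻ r in Set.Ioi (0 : ℝ), ENNReal.ofReal (r ^ (q - 1)) *
      (ENNReal.ofReal (Real.exp (-(‖r • (s : E₁)‖ ^ 2 / 2))) * A (r • (s : E₁)) *
        h (‖r • (s : E₁)‖ ^ 2)) =
      A s * (K₁ * ∫⁻ a, h a ∂gammaMeasure (((q + 2 : ℕ) : ℝ) / 2) (1 / 2)) := by
    intro s
    rw [← hK₁ h hhm, ← lintegral_const_mul _ (by fun_prop)]
    refine setLIntegral_congr_fun measurableSet_Ioi fun r hr => ?_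
    have hr0 : (0 : ℝ) < r := hr
    have e : ENNReal.ofReal (r ^ (q + 2 - 1)) =
        ENNReal.ofReal (r ^ (q - 1)) * ENNReal.ofReal (r ^ 2) := by
      rw [← ENNReal.ofReal_mul (by positivity), ← pow_add]
      congr 2
      omega
    simp only [hA2 _ _ hr0, norm_smul, norm_eq_of_mem_sphere, mul_one, Real.norm_eq_abs, sq_abs, e]
    ring
  -- The statistic divides by q, whereas an F-variable with q + 2 numerator degrees of freedom
  -- divides by q + 2; this is the factor (q+2)/q.
  have h3 : ∫⁻ x, ψ (((q : ℝ) + 2) / q * x) ∂(fDist (q + 2) m) =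
      ∫⁻ a, h a ∂gammaMeasure (((q + 2 : ℕ) : ℝ) / 2) (1 / 2) := by
    rw [lintegral_fDist (by fun_prop)]
    refine lintegral_congr fun a => lintegral_congr fun b => ?_
    congr 1
    push_cast
    have : (q : ℝ) + 2 ≠ 0 := by positivity
    rw [div_div, ← mul_div_assoc, div_mul_eq_mul_div, div_div, ← mul_assoc,
      mul_comm ((q : ℝ) + 2) a, mul_comm (q : ℝ) ((q : ℝ) + 2), mul_assoc ((q : ℝ) + 2),
      mul_comm a, mul_div_mul_left _ _ this]
  simp only [h2, h3]
  rw [lintegral_mul_const _ (by fun_prop)]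
  ring

/-- Under the null hypothesis the test statistic, under the law weighted by a quadratic function
of the first component, is a multiple of an `F`-variable. -/
theorem lintegral_canonicalLaw_null [Nontrivial E₁] [Nontrivial E₃] {q m : ℕ}
    (hE : Module.finrank ℝ E₁ = q) (hF : Module.finrank ℝ E₃ = m)
    {g : ℝ → ℝ≥0∞} (hg : Measurable g) {A : E₁ → ℝ≥0∞}
    (hA : Measurable A) (hA2 : ∀ (y : E₁) (r : ℝ), 0 < r → A (r • y) = ENNReal.ofReal (r ^ 2) * A y) :
    ∃ K : ℝ≥0∞, ∀ ψ : ℝ → ℝ≥0∞, Measurable ψ →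
      ∫⁻ z, A z.1 * ψ (‖z.1‖ ^ 2 / (q * (‖z.2.2‖ ^ 2 / m))) ∂(canonicalLaw E₂ E₃ g (0 : E₁)) =
      K * ∫⁻ x, ψ (((q : ℝ) + 2) / q * x) ∂(fDist (q + 2) m) := by
  obtain ⟨K, hK⟩ := lintegral_gaussian_ratio (E₃ := E₃) hE hF hA hA2
  set μ := (volume : Measure E₁).prod ((volume : Measure E₂).prod (volume : Measure E₃)) with hμ
  have hμH : μ.IsAddHaarMeasure := by
    have h23 : ((volume : Measure E₂).prod (volume : Measure E₃)).IsAddHaarMeasure := inferInstance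
    exact Measure.prod.instIsAddHaarMeasure _ _
  set N := Module.finrank ℝ (E₁ × (E₂ × E₃)) with hN
  obtain ⟨Kg, hKg0, hKgt, hKg⟩ := lintegral_gaussian_radius (k := N + 2) (by omega)
  set Q : E₁ × (E₂ × E₃) → ℝ := fun z => ‖z.1‖ ^ 2 + (‖z.2.1‖ ^ 2 + ‖z.2.2‖ ^ 2) with hQ
  -- The Gaussian density serves as reference: the directional factor `B` below is common to `g` and
  -- `g₀`, so the two integrals differ by the ratio `cg / Kg` of radial integrals.
  set g₀ : ℝ → ℝ≥0∞ := fun u => ENNReal.ofReal (Real.exp (-(u / 2))) with hg₀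
  have hg₀m : Measurable g₀ := by fun_prop
  set c₂ : ℝ≥0∞ := ∫⁻ v : E₂, g₀ (‖v‖ ^ 2) with hc₂
  set cg : ℝ≥0∞ := ∫⁻ r in Set.Ioi (0 : ℝ), ENNReal.ofReal (r ^ (N + 2 - 1)) * g (r ^ 2) with hcg
  have hc₀ : ∫⁻ r in Set.Ioi (0 : ℝ), ENNReal.ofReal (r ^ (N + 2 - 1)) * g₀ (r ^ 2) = Kg := by
    have := hKg (fun _ => 1) measurable_const
    have hp := isProbabilityMeasure_gammaMeasure (a := ((N + 2 : ℕ) : ℝ) / 2) (r := 1 / 2)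
      (by positivity) (by norm_num)
    rw [lintegral_one, measure_univ, mul_one] at this
    rw [← this]
    simp only [hg₀, mul_one]
  refine ⟨cg * Kg⁻¹ * (c₂ * K), fun ψ hψ => ?_⟩
  have hΨm : Measurable fun z : E₁ × (E₂ × E₃) =>
      A z.1 * ψ (‖z.1‖ ^ 2 / (q * (‖z.2.2‖ ^ 2 / m))) := by fun_prop
  -- The statistic is scale invariant, so the integrand inherits degree two from `A`.
  obtain ⟨B, hB⟩ := lintegral_homogeneous μ (Q := Q) (by fun_prop)
    (fun r z => by simp [hQ, norm_smul, mul_pow]; ring)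
    (by
      rintro ⟨w, v, t⟩ hz
      simp only [hQ]
      by_cases h1 : w = 0
      · by_cases h2 : v = 0
        · have h3 : t ≠ 0 := fun h3 => hz (by simp [h1, h2, h3])
          have := norm_pos_iff.2 h3
          positivity
        · have := norm_pos_iff.2 h2
          positivity
      · have := norm_pos_iff.2 h1
        positivity) hΨm
    (by
      intro z r hr
      simp only [Prod.smul_fst, Prod.smul_snd, hA2 _ _ hr, norm_smul, mul_pow]
      rw [mul_assoc]
      congr 3
      have : ‖r‖ ^ 2 ≠ 0 := by
        have := norm_pos_iff.2 hr.ne'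
        positivity
      rw [mul_div_assoc (‖r‖ ^ 2) (‖z.2.2‖ ^ 2), mul_left_comm, mul_div_mul_left _ _ this])
  have hgauss : ∫⁻ z, g₀ (Q z) * (A z.1 * ψ (‖z.1‖ ^ 2 / (q * (‖z.2.2‖ ^ 2 / m)))) ∂μ =
      c₂ * (K * ∫⁻ x, ψ (((q : ℝ) + 2) / q * x) ∂(fDist (q + 2) m)) := by
    have hm2 : Measurable fun z : E₁ × (E₂ × E₃) =>
      g₀ (Q z) * (A z.1 * ψ (‖z.1‖ ^ 2 / (q * (‖z.2.2‖ ^ 2 / m)))) := by fun_prop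
    rw [hμ, lintegral_prod _ hm2.aemeasurable, lintegral_swap_middle _ _ _ hm2, ← hK ψ hψ, hc₂,
      ← lintegral_mul_const _ (by fun_prop)]
    refine lintegral_congr fun v => ?_
    have hm3 : Measurable fun z : E₁ × E₃ => ENNReal.ofReal (Real.exp (-(‖z.1‖ ^ 2 / 2))) *
        ENNReal.ofReal (Real.exp (-(‖z.2‖ ^ 2 / 2))) *
        (A z.1 * ψ (‖z.1‖ ^ 2 / (q * (‖z.2‖ ^ 2 / m)))) := by fun_prop
    rw [← lintegral_const_mul _ hm3.lintegral_prod_right']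
    refine lintegral_congr fun w => ?_
    have hm4 : Measurable fun t : E₃ => ENNReal.ofReal (Real.exp (-(‖w‖ ^ 2 / 2))) *
        ENNReal.ofReal (Real.exp (-(‖t‖ ^ 2 / 2))) *
        (A w * ψ (‖w‖ ^ 2 / (q * (‖t‖ ^ 2 / m)))) := by fun_prop
    dsimp only
    rw [← lintegral_const_mul _ hm4]
    refine lintegral_congr fun t => ?_
    simp only [hg₀, hQ]
    rw [← mul_assoc, ← mul_assoc, ← ENNReal.ofReal_mul (Real.exp_nonneg _), ← mul_assoc,
      ← ENNReal.ofReal_mul (by positivity), ← Real.exp_add, ← Real.exp_add]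
    congr 5
    ring
  rw [canonicalLaw, lintegral_withDensity_eq_lintegral_mul _ (by fun_prop) hΨm]
  simp only [sub_zero, Pi.mul_apply]
  have hB1 := hB g hg
  have hB2 := hB g₀ hg₀m
  rw [hgauss, hc₀] at hB2
  rw [hB1, mul_assoc, mul_assoc c₂, hB2, mul_assoc, ← mul_assoc Kg⁻¹,
    ENNReal.inv_mul_cancel hKg0 hKgt, one_mul]

end Null

/-! ### Atoms, inverse moments and relative null risks of the F-distribution. -/

section FDistribution

theorem gammaMeasure_ae_pos (a r : ℝ) : ∀ᵐ x ∂(gammaMeasure a r), 0 < x := by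
  rw [ae_iff, show {x : ℝ | ¬0 < x} = Set.Iic 0 by ext; simp, ← lintegral_indicator_one
    measurableSet_Iic, lintegral_gammaMeasure (measurable_one.indicator measurableSet_Iic)]
  refine (setLIntegral_congr_fun measurableSet_Ioi fun x hx => ?_).trans lintegral_zero
  simp only [Set.mem_Ioi] at hx
  simp [hx]

/-- Moments of Gamma distributions. -/
theorem lintegral_rpow_gammaMeasure {a r s : ℝ} (ha : 0 < a) (hr : 0 < r) (hs : 0 < a + s) :
    ∫⁻ x, ENNReal.ofReal (x ^ s) ∂(gammaMeasure a r) =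
      ENNReal.ofReal (Real.Gamma (a + s) / (Real.Gamma a * r ^ s)) := by
  have hp := isProbabilityMeasure_gammaMeasure hs hr
  have h1 : ∫⁻ _, 1 ∂(gammaMeasure (a + s) r) = 1 := by simp
  have hG := Real.Gamma_pos_of_pos ha
  have hG' := Real.Gamma_pos_of_pos hs
  rw [lintegral_gammaMeasure (by fun_prop)] at h1 ⊢
  rw [← mul_one (ENNReal.ofReal (Real.Gamma (a + s) / _)), ← h1, ← lintegral_const_mul _ (by fun_prop)]
  refine setLIntegral_congr_fun measurableSet_Ioi fun x hx => ?_
  have hx0 : (0 : ℝ) < x := hx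
  simp only [mul_one]
  rw [← ENNReal.ofReal_mul (by positivity), ← ENNReal.ofReal_mul (by positivity)]
  congr 1
  have e1 : x ^ (a + s - 1) = x ^ (a - 1) * x ^ s := by
    rw [← Real.rpow_add hx0]; congr 1; ring
  rw [e1, Real.rpow_add hr]
  have := Real.rpow_pos_of_pos hr s
  field_simp

theorem isProbabilityMeasure_fDist {a b : ℕ} (ha : 0 < a) (hb : 0 < b) :
    IsProbabilityMeasure (fDist a b) := by
  have ha' : (0 : ℝ) < a := by exact_mod_cast ha
  have hb' : (0 : ℝ) < b := by exact_mod_cast hb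
  have := isProbabilityMeasure_gammaMeasure (a := (a : ℝ) / 2) (r := 1 / 2) (by positivity)
    (by norm_num)
  have := isProbabilityMeasure_gammaMeasure (a := (b : ℝ) / 2) (r := 1 / 2) (by positivity)
    (by norm_num)
  exact Measure.isProbabilityMeasure_map (by fun_prop)

theorem fDist_ae_pos {a b : ℕ} (ha : 0 < a) (hb : 0 < b) : ∀ᵐ x ∂(fDist a b), 0 < x := by
  have ha' : (0 : ℝ) < a := by exact_mod_cast ha
  have hb' : (0 : ℝ) < b := by exact_mod_cast hb
  rw [ae_iff, show {x : ℝ | ¬0 < x} = Set.Iic 0 by ext; simp, ← lintegral_indicator_one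
    measurableSet_Iic, lintegral_fDist (measurable_one.indicator measurableSet_Iic)]
  refine lintegral_eq_zero_of_ae_eq_zero ?_
  filter_upwards [gammaMeasure_ae_pos _ _] with x hx
  refine lintegral_eq_zero_of_ae_eq_zero ?_
  filter_upwards [gammaMeasure_ae_pos _ _] with y hy
  have : 0 < x / a / (y / b) := by positivity
  simp [Set.indicator_of_notMem, this]

/-- For a given positive numerator the ratio takes the value c at no more than one positive
denominator, and the Gamma law has no atoms. -/
theorem fDist_singleton {a b : ℕ} (ha : 0 < a) (hb : 0 < b) (c : ℝ) : fDist a b {c} = 0 := by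
  have ha' : (0 : ℝ) < a := by exact_mod_cast ha
  have hb' : (0 : ℝ) < b := by exact_mod_cast hb
  rw [← lintegral_indicator_one (measurableSet_singleton c),
    lintegral_fDist (measurable_one.indicator (measurableSet_singleton c))]
  refine lintegral_eq_zero_of_ae_eq_zero ?_
  filter_upwards [gammaMeasure_ae_pos _ _] with x hx
  refine lintegral_eq_zero_of_ae_eq_zero ?_
  have h0 : gammaMeasure ((b : ℝ) / 2) (1 / 2) {x * b / (a * c)} = 0 :=
    (withDensity_absolutelyContinuous _ _) (measure_singleton _)
  filter_upwards [gammaMeasure_ae_pos _ _, measure_eq_zero_iff_ae_notMem.1 h0] with y hy hy'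
  rw [Pi.zero_apply, Set.indicator_of_notMem]
  rw [Set.mem_singleton_iff] at hy' ⊢
  intro hc
  apply hy'
  rw [← hc]
  field_simp

theorem lintegral_inv_pow_fDist {a b : ℕ} (ha : 0 < a) (hb : 0 < b) (j : ℕ) :
    ∫⁻ x, ENNReal.ofReal (x⁻¹ ^ j) ∂(fDist a b) = ENNReal.ofReal (((a : ℝ) / b) ^ j) *
      ((∫⁻ y, ENNReal.ofReal (y ^ (j : ℝ)) ∂(gammaMeasure ((b : ℝ) / 2) (1 / 2))) *
        ∫⁻ x, ENNReal.ofReal (x ^ (-(j : ℝ))) ∂(gammaMeasure ((a : ℝ) / 2) (1 / 2))) := by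
  have ha' : (0 : ℝ) < a := by exact_mod_cast ha
  have hb' : (0 : ℝ) < b := by exact_mod_cast hb
  rw [lintegral_fDist (by fun_prop), ← lintegral_const_mul _ (by fun_prop),
    ← lintegral_const_mul _ (by fun_prop)]
  refine lintegral_congr_ae ?_
  filter_upwards [gammaMeasure_ae_pos _ _] with x hx
  rw [← lintegral_mul_const _ (by fun_prop), ← lintegral_const_mul _ (by fun_prop)]
  refine lintegral_congr_ae ?_
  filter_upwards [gammaMeasure_ae_pos _ _] with y hy
  rw [← ENNReal.ofReal_mul (by positivity), ← ENNReal.ofReal_mul (by positivity)]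
  congr 1
  rw [Real.rpow_neg hx.le, Real.rpow_natCast, Real.rpow_natCast, ← inv_pow, ← mul_pow, ← mul_pow]
  congr 1
  field_simp

/-- The first two moments of the reciprocal of an `F`-variable. -/
theorem moments_inv_fDist {q m : ℕ} (hq : 3 ≤ q) (hm : 0 < m) :
    Integrable (fun x : ℝ => x⁻¹) (fDist (q + 2) m) ∧
    Integrable (fun x : ℝ => x⁻¹ ^ 2) (fDist (q + 2) m) ∧
    ∫ x : ℝ, x⁻¹ ∂(fDist (q + 2) m) = ((q : ℝ) + 2) / q ∧
    ∫ x : ℝ, x⁻¹ ^ 2 ∂(fDist (q + 2) m) =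
      ((q : ℝ) + 2) ^ 2 * ((m : ℝ) + 2) / (m * q * ((q : ℝ) - 2)) := by
  have hq3 : (3 : ℝ) ≤ q := by exact_mod_cast hq
  have hm0 : (0 : ℝ) < m := by exact_mod_cast hm
  have hq2 : (0 : ℝ) < (q : ℝ) - 2 := by linarith
  have hpos := fDist_ae_pos (a := q + 2) (by omega) hm
  have hG1 : Real.Gamma ((m : ℝ) / 2 + 1) = (m : ℝ) / 2 * Real.Gamma ((m : ℝ) / 2) :=
    Real.Gamma_add_one (by positivity)
  have hG2 : Real.Gamma ((m : ℝ) / 2 + 2) =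
      ((m : ℝ) / 2 + 1) * ((m : ℝ) / 2 * Real.Gamma ((m : ℝ) / 2)) := by
    rw [show (m : ℝ) / 2 + 2 = (m : ℝ) / 2 + 1 + 1 by ring, Real.Gamma_add_one (by positivity), hG1]
  have hG3 : Real.Gamma (((q + 2 : ℕ) : ℝ) / 2) =
      (q : ℝ) / 2 * Real.Gamma (((q + 2 : ℕ) : ℝ) / 2 + -1) := by
    rw [show ((q + 2 : ℕ) : ℝ) / 2 = (q : ℝ) / 2 + 1 by push_cast; ring,
      Real.Gamma_add_one (by positivity), add_neg_cancel_right]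
  have hG4 : Real.Gamma (((q + 2 : ℕ) : ℝ) / 2 + -1) =
      ((q : ℝ) / 2 - 1) * Real.Gamma (((q + 2 : ℕ) : ℝ) / 2 + -2) := by
    rw [show ((q + 2 : ℕ) : ℝ) / 2 + -1 = (q : ℝ) / 2 - 1 + 1 by push_cast; ring,
      Real.Gamma_add_one (by linarith),
      show ((q + 2 : ℕ) : ℝ) / 2 + -2 = (q : ℝ) / 2 - 1 by push_cast; ring]
  have hp0 : 0 < Real.Gamma ((m : ℝ) / 2) := Real.Gamma_pos_of_pos (by positivity)
  -- The argument is q/2 - 1, positive since q ≥ 3. This is the condition for a finite second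
  -- inverse moment.
  have hp2 : 0 < Real.Gamma (((q + 2 : ℕ) : ℝ) / 2 + -2) :=
    Real.Gamma_pos_of_pos (by push_cast; linarith)
  have hp1 : 0 < Real.Gamma (((q + 2 : ℕ) : ℝ) / 2 + -1) := by
    rw [hG4]; exact mul_pos (by linarith) hp2
  have M1 : ∫⁻ x, ENNReal.ofReal x⁻¹ ∂(fDist (q + 2) m) = ENNReal.ofReal (((q : ℝ) + 2) / q) := by
    have := lintegral_inv_pow_fDist (a := q + 2) (by omega) hm 1
    simp only [pow_one] at this
    rw [this, lintegral_rpow_gammaMeasure (by positivity) (by norm_num) (by positivity),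
      lintegral_rpow_gammaMeasure (by positivity) (by norm_num) (by push_cast; linarith),
      ← ENNReal.ofReal_mul (by positivity), ← ENNReal.ofReal_mul (by positivity)]
    congr 1
    rw [Nat.cast_one, hG1, hG3, Real.rpow_one, Real.rpow_neg_one]
    generalize Real.Gamma (((q + 2 : ℕ) : ℝ) / 2 + -1) = G at hp1 ⊢
    push_cast
    field_simp
  have M2 : ∫⁻ x, ENNReal.ofReal (x⁻¹ ^ 2) ∂(fDist (q + 2) m) =
      ENNReal.ofReal (((q : ℝ) + 2) ^ 2 * ((m : ℝ) + 2) / (m * q * ((q : ℝ) - 2))) := by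
    have := lintegral_inv_pow_fDist (a := q + 2) (by omega) hm 2
    rw [this, lintegral_rpow_gammaMeasure (by positivity) (by norm_num) (by positivity),
      lintegral_rpow_gammaMeasure (by positivity) (by norm_num) (by push_cast; linarith),
      ← ENNReal.ofReal_mul (by push_cast; rw [hG2]; positivity),
      ← ENNReal.ofReal_mul (by positivity)]
    congr 1
    rw [Nat.cast_ofNat, hG2, hG3, hG4, Real.rpow_neg (by norm_num), Real.rpow_ofNat]
    generalize Real.Gamma (((q + 2 : ℕ) : ℝ) / 2 + -2) = G at hp2 ⊢
    push_cast
    have : (q : ℝ) / 2 - 1 = (q - 2) / 2 := by ring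
    rw [this]
    field_simp
  have hn1 : ∀ᵐ x ∂(fDist (q + 2) m), 0 ≤ x⁻¹ := hpos.mono fun x hx => by positivity
  have hn2 : ∀ᵐ x ∂(fDist (q + 2) m), 0 ≤ x⁻¹ ^ 2 := ae_of_all _ fun x => by positivity
  have I1 : Integrable (fun x : ℝ => x⁻¹) (fDist (q + 2) m) := by
    refine ⟨by fun_prop, ?_⟩
    rw [hasFiniteIntegral_iff_ofReal hn1, M1]
    exact ENNReal.ofReal_lt_top
  have I2 : Integrable (fun x : ℝ => x⁻¹ ^ 2) (fDist (q + 2) m) := by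
    refine ⟨by fun_prop, ?_⟩
    rw [hasFiniteIntegral_iff_ofReal hn2, M2]
    exact ENNReal.ofReal_lt_top
  refine ⟨I1, I2, ?_, ?_⟩
  · rw [integral_eq_lintegral_of_nonneg_ae hn1 I1.1, M1, ENNReal.toReal_ofReal (by positivity)]
  · rw [integral_eq_lintegral_of_nonneg_ae hn2 I2.1, M2, ENNReal.toReal_ofReal (by positivity)]

theorem shrink_pos {n p q : ℕ} (hq : 3 ≤ q) (hpn : p < n) : 0 < shrink n p q := by
  have hq3 : (3 : ℝ) ≤ q := by exact_mod_cast hq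
  have hm0 : (p : ℝ) < n := by exact_mod_cast hpn
  have h1 : (0 : ℝ) < (q : ℝ) - 2 := by linarith
  have h2 : (0 : ℝ) < (n : ℝ) - p := by linarith
  unfold shrink
  positivity

theorem integrable_stein_fDist {q m : ℕ} (hq : 3 ≤ q) (hm : 0 < m) (a : ℝ) :
    Integrable (fun x : ℝ => (1 - a * x⁻¹) ^ 2) (fDist (q + 2) m) := by
  obtain ⟨I1, I2, -, -⟩ := moments_inv_fDist hq hm
  have := isProbabilityMeasure_fDist (a := q + 2) (by omega) hm
  refine (((integrable_const (1 : ℝ)).sub (I1.const_mul (2 * a))).add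
    (I2.const_mul (a ^ 2))).congr (ae_of_all _ fun x => ?_)
  simp only [Pi.add_apply, Pi.sub_apply]
  ring

/-- The relative risk of the Stein-type estimator under the null hypothesis. -/
theorem integral_stein_fDist {n p q : ℕ} (hq : 3 ≤ q) (hpn : p < n) :
    ∫ x : ℝ, (1 - (q : ℝ) * shrink n p q / (q + 2) * x⁻¹) ^ 2 ∂(fDist (q + 2) (n - p)) =
      1 - shrink n p q := by
  have hm : 0 < n - p := by omega
  obtain ⟨I1, I2, E1, E2⟩ := moments_inv_fDist hq hm
  have := isProbabilityMeasure_fDist (a := q + 2) (by omega) hm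
  set a := (q : ℝ) * shrink n p q / (q + 2) with ha
  have hI : Integrable (fun x : ℝ => 1 - 2 * a * x⁻¹) (fDist (q + 2) (n - p)) :=
    (integrable_const (1 : ℝ)).sub (I1.const_mul (2 * a))
  have e : ∀ x : ℝ, (1 - a * x⁻¹) ^ 2 = (1 - 2 * a * x⁻¹) + a ^ 2 * x⁻¹ ^ 2 := fun x => by ring
  simp only [e]
  -- For a = qd/(q+2) the linear term contributes -2d, and the value of d makes the quadratic term
  -- equal to d.
  rw [integral_add hI (I2.const_mul _), integral_sub (integrable_const _) (I1.const_mul _),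
    integral_const_mul, integral_const_mul, E1, E2, integral_const, probReal_univ, ha, shrink]
  have hq3 : (3 : ℝ) ≤ q := by exact_mod_cast hq
  have hm0 : (0 : ℝ) < ((n - p : ℕ) : ℝ) := by exact_mod_cast hm
  have h1 : (0 : ℝ) < (q : ℝ) - 2 := by linarith
  rw [← Nat.cast_sub hpn.le]
  simp only [smul_eq_mul]
  field_simp
  ring

theorem lintegral_stein_fDist {n p q : ℕ} (hq : 3 ≤ q) (hpn : p < n) :
    ∫⁻ x : ℝ, ENNReal.ofReal ((1 - shrink n p q * (((q : ℝ) + 2) / q * x)⁻¹) ^ 2)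
      ∂(fDist (q + 2) (n - p)) = ENNReal.ofReal (1 - shrink n p q) := by
  have hm : 0 < n - p := by omega
  have hq0 : (0 : ℝ) < q := by exact_mod_cast (by omega : 0 < q)
  rw [← integral_stein_fDist hq hpn, ofReal_integral_eq_lintegral_ofReal
    (integrable_stein_fDist hq hm _) (ae_of_all _ fun x => by positivity)]
  refine lintegral_congr fun x => ?_
  rw [mul_inv, inv_div]
  congr 3
  ring

/-- The positive rule deletes from the Stein integral the region F ≤ qd/(q+2), which is where L ≤ d;
the deleted mass is `posGain`. -/
theorem lintegral_steinPos_fDist {n p q : ℕ} (hq : 3 ≤ q) (hpn : p < n) :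
    ∫⁻ x : ℝ, ENNReal.ofReal ((if shrink n p q < ((q : ℝ) + 2) / q * x then
        1 - shrink n p q * (((q : ℝ) + 2) / q * x)⁻¹ else 0) ^ 2) ∂(fDist (q + 2) (n - p)) =
      ENNReal.ofReal (1 - shrink n p q - posGain n p q) := by
  have hm : 0 < n - p := by omega
  have hq0 : (0 : ℝ) < q := by exact_mod_cast (by omega : 0 < q)
  set a := (q : ℝ) * shrink n p q / (q + 2) with ha
  have hI := integrable_stein_fDist hq hm a
  have hsplit := integral_add_compl (measurableSet_Iic (a := a)) hI
  rw [integral_stein_fDist hq hpn] at hsplit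
  have e : 1 - shrink n p q - posGain n p q =
      ∫ x in (Set.Iic a)ᶜ, (1 - a * x⁻¹) ^ 2 ∂(fDist (q + 2) (n - p)) := by
    rw [← hsplit, posGain]; ring
  rw [e, ofReal_integral_eq_lintegral_ofReal hI.integrableOn
    (ae_of_all _ fun x => by positivity), ← lintegral_indicator measurableSet_Iic.compl]
  refine lintegral_congr fun x => ?_
  have hiff : shrink n p q < ((q : ℝ) + 2) / q * x ↔ x ∈ (Set.Iic a)ᶜ := by
    rw [Set.mem_compl_iff, Set.mem_Iic, not_le, ha, div_lt_iff₀ (by positivity),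
      div_mul_eq_mul_div, lt_div_iff₀ hq0, mul_comm (shrink n p q), mul_comm x]
  rw [Set.indicator_apply]
  simp only [hiff]
  split_ifs with h
  · rw [mul_inv, inv_div, ha]
    congr 3
    ring
  · simp

/-- The squared factor is an indicator, and the absence of atoms lets F ≥ b be replaced by F > b,
the complement counted by `distFun`. -/
theorem lintegral_prelim_fDist {q m : ℕ} (hq : 0 < q) (hm : 0 < m) (c : ℝ) :
    ∫⁻ x : ℝ, ENNReal.ofReal ((if c ≤ ((q : ℝ) + 2) / q * x then 1 else 0) ^ 2)
      ∂(fDist (q + 2) m) = ENNReal.ofReal (1 - distFun (fDist (q + 2) m) (q * c / (q + 2))) := by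
  have hq0 : (0 : ℝ) < q := by exact_mod_cast hq
  have := isProbabilityMeasure_fDist (a := q + 2) (by omega) hm
  set b := (q : ℝ) * c / (q + 2) with hb
  have e : ∀ x : ℝ, ENNReal.ofReal ((if c ≤ ((q : ℝ) + 2) / q * x then 1 else 0) ^ 2) =
      (Set.Ici b).indicator 1 x := by
    intro x
    have hiff : c ≤ ((q : ℝ) + 2) / q * x ↔ x ∈ Set.Ici b := by
      rw [Set.mem_Ici, hb, div_le_iff₀ (by positivity),
        div_mul_eq_mul_div, le_div_iff₀ hq0, mul_comm c, mul_comm x]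
    rw [Set.indicator_apply]
    simp only [hiff]
    split_ifs <;> simp
  simp only [e]
  rw [lintegral_indicator_one measurableSet_Ici, distFun,
    ← probReal_compl_eq_one_sub measurableSet_Iic, Measure.real,
    ENNReal.ofReal_toReal (measure_ne_top _ _), Set.compl_Iic]
  exact (measure_congr (Ioi_ae_eq_Ici' (fDist_singleton (by omega) hm b))).symm

/-- A point below the infimum lies outside the set, provided the set is bounded below. It is, by 0,
because an F-variable is positive and u > 0. -/
theorem distFun_lt_of_lt_quantile {a b : ℕ} (ha : 0 < a) (hb : 0 < b) {u x : ℝ} (hu : 0 < u)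
    (hx : x < quantile (fDist a b) u) : distFun (fDist a b) x < u := by
  by_contra! h
  have hbdd : BddBelow {x : ℝ | u ≤ distFun (fDist a b) x} := by
    refine ⟨0, fun y hy => ?_⟩
    by_contra! hy0
    have : fDist a b (Set.Iic y) = 0 := by
      refine measure_mono_null ?_ (ae_iff.1 (fDist_ae_pos ha hb))
      intro z hz
      simp only [Set.mem_Iic] at hz
      simp only [Set.mem_ofPred_eq, not_lt]
      linarith
    simp only [distFun, Measure.real, this, Set.mem_ofPred_eq, ENNReal.toReal_zero] at hy
    linarith
  exact (not_lt.2 (csInf_le hbdd h)) hx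

end FDistribution

/-! ### Factorisation of positive definite matrices and orthonormal kernels. -/

section LinearAlgebra

open scoped MatrixOrder in
theorem exists_factor_of_posDef {k : ℕ} {S : Matrix (Fin k) (Fin k) ℝ} (hS : S.PosDef) :
    ∃ R : Matrix (Fin k) (Fin k) ℝ, S = Rᵀ * R ∧ IsUnit R.det := by
  obtain ⟨R, hR⟩ := CStarAlgebra.nonneg_iff_eq_star_mul_self.mp hS.posSemidef.nonneg
  rw [star_eq_conjTranspose, conjTranspose_eq_transpose_of_trivial] at hR
  refine ⟨R, hR, ?_⟩
  have h := (isUnit_iff_isUnit_det S).1 hS.isUnit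
  rw [hR, det_mul, det_transpose] at h
  exact isUnit_of_mul_isUnit_left h

theorem dotProduct_mulVec_mulVec {k l₁ l₂ : ℕ} (A : Matrix (Fin k) (Fin l₁) ℝ)
    (S : Matrix (Fin k) (Fin k) ℝ) (B : Matrix (Fin k) (Fin l₂) ℝ) (x : Fin l₁ → ℝ)
    (y : Fin l₂ → ℝ) : (A *ᵥ x) ⬝ᵥ S *ᵥ (B *ᵥ y) = x ⬝ᵥ (Aᵀ * S * B) *ᵥ y := by
  rw [← mulVec_mulVec, ← mulVec_mulVec, dotProduct_mulVec x Aᵀ, vecMul_transpose]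

theorem mulVec_injective_of_rank {k l : ℕ} {A : Matrix (Fin k) (Fin l) ℝ} (hA : A.rank = l) :
    Function.Injective A.mulVec := by
  have h := A.mulVecLin.finrank_range_add_finrank_ker
  rw [Module.finrank_fin_fun] at h
  have h0 : Module.finrank ℝ (LinearMap.ker A.mulVecLin) = 0 := by
    have : Module.finrank ℝ (LinearMap.range A.mulVecLin) = l := hA
    omega
  have := LinearMap.ker_eq_bot.1 (Submodule.finrank_eq_zero.1 h0)
  exact this

/-- An `S`-orthonormal basis of the kernel of `N`. -/
theorem exists_orthonormal_kernel {k l r : ℕ} {S : Matrix (Fin k) (Fin k) ℝ} (hS : S.PosDef)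
    (N : Matrix (Fin l) (Fin k) ℝ) (hr : N.rank + r = k) :
    ∃ B : Matrix (Fin k) (Fin r) ℝ, N * B = 0 ∧ Bᵀ * S * B = 1 := by
  obtain ⟨R, rfl, hRu⟩ := exists_factor_of_posDef hS
  -- With S = RᵀR, the map R carries the S-inner product to the standard one. An orthonormal basis
  -- of the kernel of N R⁻¹ is found there and pulled back by R⁻¹.
  set K : Submodule ℝ (EuclideanSpace ℝ (Fin k)) :=
    LinearMap.ker ((N * R⁻¹).mulVecLin ∘ₗ (WithLp.linearEquiv 2 ℝ (Fin k → ℝ)).toLinearMap) with hK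
  have hdim : Module.finrank ℝ K = r := by
    have h := LinearMap.finrank_range_add_finrank_ker
      ((N * R⁻¹).mulVecLin ∘ₗ (WithLp.linearEquiv 2 ℝ (Fin k → ℝ)).toLinearMap)
    rw [LinearMap.range_comp, LinearEquiv.range, Submodule.map_top, finrank_euclideanSpace_fin, ← hK] at h
    have h2 : Module.finrank ℝ (LinearMap.range (N * R⁻¹).mulVecLin) = N.rank := by
      have hu : IsUnit (R⁻¹).det := by
        rw [det_nonsing_inv]; exact hRu.ringInverse
      exact rank_mul_eq_left_of_isUnit_det _ N hu
    have h3 : N.rank + Module.finrank ℝ K = k := by rw [← h2]; exact h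
    omega
  set b := (stdOrthonormalBasis ℝ K).reindex (finCongr hdim) with hb
  set U : Matrix (Fin k) (Fin r) ℝ := Matrix.of fun i j => (b j : EuclideanSpace ℝ (Fin k)) i
    with hU
  refine ⟨R⁻¹ * U, ?_, ?_⟩
  · ext i j
    have hj : (N * R⁻¹) *ᵥ (b j : EuclideanSpace ℝ (Fin k)).ofLp = 0 := (b j).2
    have := congrFun hj i
    rw [← Matrix.mul_assoc, Matrix.mul_apply]
    exact this
  · have e : (R⁻¹ * U)ᵀ * (Rᵀ * R) * (R⁻¹ * U) = Uᵀ * U := by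
      have h1 : R * R⁻¹ = 1 := mul_nonsing_inv _ hRu
      have h2 : R⁻¹ᵀ * Rᵀ = 1 := by rw [← transpose_mul, h1, transpose_one]
      calc (R⁻¹ * U)ᵀ * (Rᵀ * R) * (R⁻¹ * U) = Uᵀ * (R⁻¹ᵀ * Rᵀ) * (R * R⁻¹) * U := by
            rw [transpose_mul]; simp only [Matrix.mul_assoc]
        _ = Uᵀ * U := by rw [h1, h2, Matrix.mul_one, Matrix.mul_one]
    rw [e]
    ext i j
    have := (orthonormal_iff_ite.1 b.orthonormal) i j
    rw [Submodule.coe_inner, PiLp.inner_apply] at this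
    rw [Matrix.mul_apply, Matrix.one_apply, ← this]
    simp [hU, mul_comm]

theorem euclidean_norm_sq {k : ℕ} (x : EuclideanSpace ℝ (Fin k)) : ‖x‖ ^ 2 = x.ofLp ⬝ᵥ x.ofLp := by
  rw [EuclideanSpace.real_norm_sq_eq, dotProduct]
  simp only [pow_two]

end LinearAlgebra

/-! ### Canonical coordinates of the regression model. -/

namespace Design

variable {n p q : ℕ} (D : Design n p q)

theorem C_posDef : D.C.PosDef := by
  have := D.V_posDef.inv.conjTranspose_mul_mul_same (mulVec_injective_of_rank D.X_rank)
  rwa [conjTranspose_eq_transpose_of_trivial] at this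

theorem HCH_posDef : (D.H * D.C⁻¹ * D.Hᵀ).PosDef := by
  have h : Function.Injective D.H.vecMul := by
    have := mulVec_injective_of_rank (A := D.Hᵀ) (by rw [rank_transpose, D.H_rank])
    intro x y hxy
    apply this
    rw [mulVec_transpose, mulVec_transpose]
    exact hxy
  have := D.C_posDef.inv.mul_mul_conjTranspose_same h
  rwa [conjTranspose_eq_transpose_of_trivial] at this

/-- The columns of B are V⁻¹-orthogonal to those of X, so the normal equations do not see t. -/
theorem gls_eq {r : ℕ} {B : Matrix (Fin n) (Fin r) ℝ} (hB : D.Xᵀ * D.V⁻¹ * B = 0)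
    (γ : Fin p → ℝ) (t : Fin r → ℝ) : D.gls (D.X *ᵥ γ + B *ᵥ t) = γ := by
  have hC : IsUnit D.C.det := (isUnit_iff_isUnit_det _).1 D.C_posDef.isUnit
  have h : D.Xᵀ *ᵥ (D.V⁻¹ *ᵥ (D.X *ᵥ γ + B *ᵥ t)) = D.C *ᵥ γ := by
    rw [mulVec_add, mulVec_add, mulVec_mulVec, mulVec_mulVec, mulVec_mulVec, mulVec_mulVec,
      hB, zero_mulVec, add_zero, C]
  rw [gls, h, mulVec_mulVec, nonsing_inv_mul _ hC, one_mulVec]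

/-- Canonical coordinates of the error vector: `x` for the part tested by the hypothesis, `v` for
the rest of the regression space, and `t` for the residual. -/
theorem exists_canonicalForm (hqp : q < p) (hpn : p < n) (β : Fin p → ℝ) :
    ∃ (T : (EuclideanSpace ℝ (Fin q) × (EuclideanSpace ℝ (Fin (p - q)) ×
        EuclideanSpace ℝ (Fin (n - p)))) ≃ₗ[ℝ] (Fin n → ℝ))
      (B₁ : EuclideanSpace ℝ (Fin q) →ₗ[ℝ] (Fin p → ℝ))
      (B₂ : EuclideanSpace ℝ (Fin (p - q)) →ₗ[ℝ] (Fin p → ℝ)) (θ : EuclideanSpace ℝ (Fin q)),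
      (∀ z, T z ⬝ᵥ D.V⁻¹ *ᵥ T z = ‖z.1‖ ^ 2 + (‖z.2.1‖ ^ 2 + ‖z.2.2‖ ^ 2)) ∧
      (∀ z, D.gls (D.X *ᵥ β + T z) = β + (B₁ z.1 + B₂ z.2.1)) ∧
      (∀ z, D.restricted (D.X *ᵥ β + T z) = D.gls (D.X *ᵥ β + T z) - B₁ (z.1 + θ)) ∧
      (∀ z, D.stat (D.X *ᵥ β + T z) =
        ‖z.1 + θ‖ ^ 2 / (q * (‖z.2.2‖ ^ 2 / ((n - p : ℕ) : ℝ)))) ∧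
      (D.Null β → θ = 0) ∧
      (∀ a v, (B₁ a + B₂ v) ⬝ᵥ D.C *ᵥ (B₁ a + B₂ v) = ‖a‖ ^ 2 + ‖v‖ ^ 2) := by
  have hCu : IsUnit D.C.det := (isUnit_iff_isUnit_det _).1 D.C_posDef.isUnit
  have hMu : IsUnit (D.H * D.C⁻¹ * D.Hᵀ).det := (isUnit_iff_isUnit_det _).1 D.HCH_posDef.isUnit
  have hCs : D.C⁻¹ᵀ = D.C⁻¹ := by
    have := D.C_posDef.inv.isHermitian.eq
    rwa [conjTranspose_eq_transpose_of_trivial] at this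
  have hVs : D.V⁻¹ᵀ = D.V⁻¹ := by
    have := D.V_posDef.inv.isHermitian.eq
    rwa [conjTranspose_eq_transpose_of_trivial] at this
  obtain ⟨R, hR, hRu⟩ := exists_factor_of_posDef D.HCH_posDef.inv
  obtain ⟨N₂, hN₂, hN₂'⟩ := exists_orthonormal_kernel (r := p - q) D.C_posDef D.H
    (by rw [D.H_rank]; omega)
  obtain ⟨N₃, hN₃, hN₃'⟩ := exists_orthonormal_kernel (r := n - p) D.V_posDef.inv (D.Xᵀ * D.V⁻¹)
    (by
      rw [rank_mul_eq_left_of_isUnit_det _ _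
        ((isUnit_iff_isUnit_det _).1 D.V_posDef.inv.isUnit), rank_transpose, D.X_rank]
      omega)
  -- With V₁ = RᵀR, the columns of `N₁` form a C-orthonormal basis of the C-orthogonal complement of
  -- ker H, while those of `N₂` span ker H. The inverse of `D.H * N₁` is `R`.
  set N₁ : Matrix (Fin p) (Fin q) ℝ := D.C⁻¹ * D.Hᵀ * Rᵀ with hN₁
  have hV₁ : D.V₁ = Rᵀ * R := hR
  have hHN : D.H * N₁ * R = 1 := by
    rw [hN₁, ← Matrix.mul_assoc, ← Matrix.mul_assoc, Matrix.mul_assoc _ Rᵀ, ← hR,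
      mul_nonsing_inv _ hMu]
  have hRHN : R * (D.H * N₁) = 1 := mul_eq_one_comm.1 hHN
  have hN₁t : N₁ᵀ * D.C = R * D.H := by
    rw [hN₁, transpose_mul, transpose_mul, transpose_transpose, transpose_transpose, hCs,
      Matrix.mul_assoc, Matrix.mul_assoc, nonsing_inv_mul _ hCu, Matrix.mul_one]
  have h11 : N₁ᵀ * D.C * N₁ = 1 := by rw [hN₁t, Matrix.mul_assoc, hRHN]
  have h12 : N₁ᵀ * D.C * N₂ = 0 := by rw [hN₁t, Matrix.mul_assoc, hN₂, Matrix.mul_zero]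
  have h21 : N₂ᵀ * D.C * N₁ = 0 := by
    have hCt : D.Cᵀ = D.C := by
      have := D.C_posDef.isHermitian.eq
      rwa [conjTranspose_eq_transpose_of_trivial] at this
    have := congrArg Matrix.transpose h12
    rwa [transpose_mul, transpose_mul, transpose_transpose, transpose_zero, hCt,
      ← Matrix.mul_assoc] at this
  have hC : ∀ a v, (N₁ *ᵥ a + N₂ *ᵥ v) ⬝ᵥ D.C *ᵥ (N₁ *ᵥ a + N₂ *ᵥ v) = a ⬝ᵥ a + v ⬝ᵥ v := by
    intro a v
    simp only [mulVec_add, add_dotProduct, dotProduct_add, dotProduct_mulVec_mulVec, h11, h12, h21,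
      hN₂', one_mulVec, zero_mulVec, dotProduct_zero, add_zero, zero_add]
  have hT : ∀ b t, (D.X *ᵥ b + N₃ *ᵥ t) ⬝ᵥ D.V⁻¹ *ᵥ (D.X *ᵥ b + N₃ *ᵥ t) =
      b ⬝ᵥ D.C *ᵥ b + t ⬝ᵥ t := by
    intro b t
    have h31 : N₃ᵀ * D.V⁻¹ * D.X = 0 := by
      have := congrArg Matrix.transpose hN₃
      rwa [transpose_mul, transpose_mul, transpose_transpose, transpose_zero, hVs,
        ← Matrix.mul_assoc] at this
    simp only [mulVec_add, add_dotProduct, dotProduct_add, dotProduct_mulVec_mulVec, hN₃, h31,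
      hN₃', one_mulVec, zero_mulVec, dotProduct_zero, add_zero, zero_add]
    rfl
  set L : ∀ k : ℕ, EuclideanSpace ℝ (Fin k) →ₗ[ℝ] (Fin k → ℝ) :=
    fun k => (WithLp.linearEquiv 2 ℝ (Fin k → ℝ)).toLinearMap with hL
  set B₁ := N₁.mulVecLin ∘ₗ L q with hB₁
  set B₂ := N₂.mulVecLin ∘ₗ L (p - q) with hB₂
  set T₀ : (EuclideanSpace ℝ (Fin q) × (EuclideanSpace ℝ (Fin (p - q)) ×
      EuclideanSpace ℝ (Fin (n - p)))) →ₗ[ℝ] (Fin n → ℝ) :=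
    D.X.mulVecLin ∘ₗ (B₁.coprod (B₂ ∘ₗ LinearMap.fst ℝ _ _)) +
      (N₃.mulVecLin ∘ₗ L (n - p)) ∘ₗ LinearMap.snd ℝ _ _ ∘ₗ LinearMap.snd ℝ _ _ with hT₀
  have hT₀a : ∀ z, T₀ z = D.X *ᵥ (B₁ z.1 + B₂ z.2.1) + N₃ *ᵥ z.2.2.ofLp := fun z => rfl
  have hB₁a : ∀ a, B₁ a = N₁ *ᵥ a.ofLp := fun a => rfl
  have hB₂a : ∀ a, B₂ a = N₂ *ᵥ a.ofLp := fun a => rfl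
  have hT₀n : ∀ z, T₀ z ⬝ᵥ D.V⁻¹ *ᵥ T₀ z = ‖z.1‖ ^ 2 + (‖z.2.1‖ ^ 2 + ‖z.2.2‖ ^ 2) := by
    intro z
    rw [hT₀a, hT, hB₁a, hB₂a, hC, euclidean_norm_sq, euclidean_norm_sq, euclidean_norm_sq, add_assoc]
  have hinj : Function.Injective T₀ := by
    rw [← LinearMap.ker_eq_bot, LinearMap.ker_eq_bot']
    intro z hz
    have := hT₀n z
    rw [hz, zero_dotProduct] at this
    have g1 := sq_nonneg ‖z.1‖
    have g2 := sq_nonneg ‖z.2.1‖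
    have g3 := sq_nonneg ‖z.2.2‖
    have h1 : ‖z.1‖ ^ 2 = 0 := by linarith
    have h2 : ‖z.2.1‖ ^ 2 = 0 := by linarith
    have h3 : ‖z.2.2‖ ^ 2 = 0 := by linarith
    exact Prod.ext (by simpa using h1) (Prod.ext (by simpa using h2) (by simpa using h3))
  -- Bijectivity follows from injectivity by counting q + (p - q) + (n - p) = n.
  set T := T₀.linearEquivOfInjective hinj (by simp; omega) with hTdef
  have hTa : ∀ z, T z = T₀ z := fun z => rfl
  -- Chosen so that H N₁ θ = Hβ - h; thus H β̃ - h is the image of x + θ.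
  set θ : EuclideanSpace ℝ (Fin q) := WithLp.toLp 2 (R *ᵥ (D.H *ᵥ β - D.h)) with hθ
  have hg : ∀ z, D.gls (D.X *ᵥ β + T z) = β + (B₁ z.1 + B₂ z.2.1) := by
    intro z
    rw [hTa, hT₀a, ← add_assoc, ← mulVec_add, D.gls_eq hN₃]
  have hH : ∀ z, D.H *ᵥ D.gls (D.X *ᵥ β + T z) - D.h = (D.H * N₁) *ᵥ (z.1 + θ).ofLp := by
    intro z
    rw [hg, mulVec_add, mulVec_add, hB₁a, hB₂a, mulVec_mulVec, mulVec_mulVec, hN₂, zero_mulVec,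
      add_zero, WithLp.ofLp_add, mulVec_add, hθ, mulVec_mulVec, hHN, one_mulVec]
    abel
  refine ⟨T, B₁, B₂, θ, hT₀n, hg, ?_, ?_, ?_, ?_⟩
  · intro z
    have e : D.C⁻¹ * D.Hᵀ * (Rᵀ * R) * (D.H * N₁) = N₁ := by
      calc D.C⁻¹ * D.Hᵀ * (Rᵀ * R) * (D.H * N₁) = N₁ * (R * (D.H * N₁)) := by
            rw [hN₁]; simp only [Matrix.mul_assoc]
        _ = N₁ := by rw [hRHN, Matrix.mul_one]
    rw [restricted, hH, hV₁, mulVec_mulVec, mulVec_mulVec, mulVec_mulVec, e, hB₁a]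
  · intro z
    have h1 : D.X *ᵥ β + T z - D.X *ᵥ D.gls (D.X *ᵥ β + T z) = N₃ *ᵥ z.2.2.ofLp := by
      rw [hg, hTa, hT₀a]; simp only [mulVec_add]; abel
    rw [stat, S2, h1, hH, dotProduct_mulVec_mulVec, dotProduct_mulVec_mulVec, hN₃', one_mulVec,
      ← euclidean_norm_sq, ← Nat.cast_sub hpn.le, hV₁]
    have h2 : (D.H * N₁)ᵀ * (Rᵀ * R) * (D.H * N₁) = 1 := by
      calc (D.H * N₁)ᵀ * (Rᵀ * R) * (D.H * N₁) = (R * (D.H * N₁))ᵀ * (R * (D.H * N₁)) := by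
            rw [transpose_mul R]; simp only [Matrix.mul_assoc]
        _ = 1 := by rw [hRHN, transpose_one, Matrix.mul_one]
    rw [h2, one_mulVec, ← euclidean_norm_sq]
  · intro h0
    rw [Null] at h0
    rw [hθ, h0, sub_self, mulVec_zero]
    rfl
  · intro a v
    rw [hB₁a, hB₂a, hC, euclidean_norm_sq, euclidean_norm_sq]

end Design

/-! ### Transfer of laws and risks to canonical coordinates. -/

namespace Design

/-- Change of variables to canonical coordinates centred at `-θ`. -/
theorem exists_canonicalLaw {Ω : Type*} [MeasurableSpace Ω] {P : Measure Ω}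
    {n q r m : ℕ} {V : Matrix (Fin n) (Fin n) ℝ} {σ : ℝ} {g : ℝ → ℝ} (hg : Measurable g)
    {ε : Ω → Fin n → ℝ} (hε : HasEllipticalDensity P ε σ V g)
    (T : (EuclideanSpace ℝ (Fin q) × (EuclideanSpace ℝ (Fin r) ×
        EuclideanSpace ℝ (Fin m))) ≃ₗ[ℝ] (Fin n → ℝ))
    (hT : ∀ z, T z ⬝ᵥ V⁻¹ *ᵥ T z = ‖z.1‖ ^ 2 + (‖z.2.1‖ ^ 2 + ‖z.2.2‖ ^ 2))
    (θ : EuclideanSpace ℝ (Fin q)) :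
    ∃ G : ℝ → ℝ≥0∞, Measurable G ∧ ∀ Λ : (EuclideanSpace ℝ (Fin q) × (EuclideanSpace ℝ (Fin r) ×
        EuclideanSpace ℝ (Fin m))) → ℝ≥0∞, Measurable Λ →
      ∫⁻ ω, Λ (T.symm (ε ω)) ∂P = ∫⁻ z, Λ (z.1 - θ, z.2) ∂(canonicalLaw
        (EuclideanSpace ℝ (Fin r)) (EuclideanSpace ℝ (Fin m)) G θ) := by
  obtain ⟨hεm, c, -, hmap⟩ := hε
  set μ := (volume : Measure (EuclideanSpace ℝ (Fin q))).prod
    ((volume : Measure (EuclideanSpace ℝ (Fin r))).prod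
      (volume : Measure (EuclideanSpace ℝ (Fin m)))) with hμ
  have hμH : μ.IsAddHaarMeasure := by
    have h23 : ((volume : Measure (EuclideanSpace ℝ (Fin r))).prod
      (volume : Measure (EuclideanSpace ℝ (Fin m)))).IsAddHaarMeasure := inferInstance
    exact Measure.prod.instIsAddHaarMeasure _ _
  have hTm : Measurable T := T.toContinuousLinearEquiv.continuous.measurable
  have hTsm : Measurable T.symm := T.symm.toContinuousLinearEquiv.continuous.measurable
  have hmH : (μ.map T).IsAddHaarMeasure :=
    T.toContinuousLinearEquiv.isAddHaarMeasure_map μ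
  -- Uniqueness of Haar measure supplies the Jacobian of `T` as an unspecified constant, which `G`
  -- absorbs along with the normalisation and the scale.
  set K : ℝ≥0∞ := ((volume : Measure (Fin n → ℝ)).addHaarScalarFactor (μ.map T) : ℝ≥0∞) with hK
  have hvol : (volume : Measure (Fin n → ℝ)) = K • μ.map T :=
    Measure.isAddLeftInvariant_eq_smul _ _
  set G : ℝ → ℝ≥0∞ := fun u => K * ENNReal.ofReal (c * (Real.sqrt (σ ^ 2 • V).det)⁻¹ *
    g (u / σ ^ 2)) with hG
  have hGm : Measurable G := by fun_prop
  refine ⟨G, hGm, fun Λ hΛ => ?_⟩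
  have hρ : Measurable fun e : Fin n → ℝ => ENNReal.ofReal (c * (Real.sqrt (σ ^ 2 • V).det)⁻¹ *
      g ((e ⬝ᵥ V⁻¹ *ᵥ e) / σ ^ 2)) := by
    have : Measurable fun e : Fin n → ℝ => e ⬝ᵥ V⁻¹ *ᵥ e := by
      refine Continuous.measurable ?_
      fun_prop
    fun_prop
  have hΛT : Measurable fun e => Λ (T.symm e) := hΛ.comp hTsm
  have hshift : Measurable fun z : EuclideanSpace ℝ (Fin q) × (EuclideanSpace ℝ (Fin r) ×
        EuclideanSpace ℝ (Fin m)) => Λ (z.1 - θ, z.2) := hΛ.comp (by fun_prop)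
  rw [← lintegral_map' (f := fun e => Λ (T.symm e)) (by rw [hmap]; exact hΛT.aemeasurable) hεm,
    hmap, lintegral_withDensity_eq_lintegral_mul _ hρ hΛT, hvol, lintegral_smul_measure,
    lintegral_map (hρ.mul hΛT) hTm, lintegral_canonicalLaw hGm θ hshift, smul_eq_mul]
  simp only [Pi.mul_apply, hT, LinearEquiv.symm_apply_apply]
  rw [← lintegral_const_mul _ (by fun_prop)]
  have hm : Measurable fun z : EuclideanSpace ℝ (Fin q) × (EuclideanSpace ℝ (Fin r) ×
        EuclideanSpace ℝ (Fin m)) => G (‖z.1‖ ^ 2 + (‖z.2.1‖ ^ 2 + ‖z.2.2‖ ^ 2)) * Λ z := by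
    fun_prop
  simp only [← mul_assoc]
  rw [hμ]
  refine (lintegral_prod _ hm.aemeasurable).trans ?_
  rw [← lintegral_sub_right_eq_self _ θ]

/-- The risks of all shrinkage estimators, expressed under the canonical law. -/
theorem exists_canonical_risk {Ω : Type*} [MeasurableSpace Ω] {P : Measure Ω}
    [IsProbabilityMeasure P] {n p q : ℕ} (hqp : q < p) (hpn : p < n) (D : Design n p q) {σ : ℝ}
    {g : ℝ → ℝ} (hg : Measurable g) {ε : Ω → Fin n → ℝ}
    (hε : HasEllipticalDensity P ε σ D.V g) (hcov : Integrable (fun ω => ε ω ⬝ᵥ ε ω) P)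
    (β : Fin p → ℝ) :
    ∃ (G : ℝ → ℝ≥0∞) (θ : EuclideanSpace ℝ (Fin q))
      (ν : Measure (EuclideanSpace ℝ (Fin q) × (EuclideanSpace ℝ (Fin (p - q)) ×
        EuclideanSpace ℝ (Fin (n - p))))),
      ν = canonicalLaw _ _ G θ ∧ Measurable G ∧ IsProbabilityMeasure ν ∧ (D.Null β → θ = 0) ∧
      ∫⁻ z, ENNReal.ofReal (‖z.1 - θ‖ ^ 2) ∂ν < ⊤ ∧
      ∫⁻ z, ENNReal.ofReal (‖z.2.1‖ ^ 2) ∂ν < ⊤ ∧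
      ∀ W : Matrix (Fin p) (Fin p) ℝ, W.PosDef →
        ∃ (N₁ : EuclideanSpace ℝ (Fin q) →L[ℝ] EuclideanSpace ℝ (Fin p))
          (N₂ : EuclideanSpace ℝ (Fin (p - q)) →L[ℝ] EuclideanSpace ℝ (Fin p)),
          (∀ a, N₁ a = 0 → a = 0) ∧
          (W = D.C → ∀ a v, ‖N₁ a + N₂ v‖ ^ 2 = ‖a‖ ^ 2 + ‖v‖ ^ 2) ∧
          ∀ (ψ : ℝ → ℝ), Measurable ψ → ∀ δ : (Fin n → ℝ) → Fin p → ℝ,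
            (∀ y, δ y = D.restricted y + ψ (D.stat y) • (D.gls y - D.restricted y)) →
            D.risk P ε W δ β = ∫⁻ z, ENNReal.ofReal (‖N₁ (ψ (‖z.1‖ ^ 2 /
              (q * (‖z.2.2‖ ^ 2 / ((n - p : ℕ) : ℝ)))) • z.1 - θ) + N₂ z.2.1‖ ^ 2) ∂ν := by
  obtain ⟨T, B₁, B₂, θ, hTn, hgls, hres, hstat, hnull, hCn⟩ := D.exists_canonicalForm hqp hpn β
  obtain ⟨G, hG, hlaw⟩ := exists_canonicalLaw hg hε T hTn θ
  set ν := canonicalLaw (EuclideanSpace ℝ (Fin (p - q))) (EuclideanSpace ℝ (Fin (n - p))) G θ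
    with hν
  -- Boundedness of the inverse of `T` carries the finite second moment of the errors to the
  -- canonical coordinates.
  have hbound : ∃ K : ℝ, ∀ e : Fin n → ℝ, ‖T.symm e‖ ^ 2 ≤ K * (e ⬝ᵥ e) := by
    set S := T.symm.toContinuousLinearEquiv.toContinuousLinearMap
    refine ⟨‖S‖ ^ 2, fun e => ?_⟩
    have h1 : ‖T.symm e‖ ≤ ‖S‖ * ‖e‖ := S.le_opNorm e
    have h0 : 0 ≤ e ⬝ᵥ e := Finset.sum_nonneg fun i _ => mul_self_nonneg (e i)
    have h2 : ‖e‖ ≤ Real.sqrt (e ⬝ᵥ e) := by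
      refine (pi_norm_le_iff_of_nonneg (Real.sqrt_nonneg _)).2 fun i => ?_
      refine Real.abs_le_sqrt ?_
      rw [pow_two]
      exact Finset.single_le_sum (f := fun i => e i * e i) (fun i _ => mul_self_nonneg (e i))
        (Finset.mem_univ i)
    calc ‖T.symm e‖ ^ 2 ≤ (‖S‖ * ‖e‖) ^ 2 := by gcongr
      _ = ‖S‖ ^ 2 * ‖e‖ ^ 2 := by ring
      _ ≤ ‖S‖ ^ 2 * Real.sqrt (e ⬝ᵥ e) ^ 2 := by gcongr
      _ = _ := by rw [Real.sq_sqrt h0]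
  obtain ⟨K, hK⟩ := hbound
  have hfin : ∀ f : EuclideanSpace ℝ (Fin q) × (EuclideanSpace ℝ (Fin (p - q)) ×
      EuclideanSpace ℝ (Fin (n - p))) → ℝ, (∀ z, f z ≤ ‖z‖ ^ 2) →
      ∫⁻ ω, ENNReal.ofReal (f (T.symm (ε ω))) ∂P < ⊤ := by
    intro f hf
    refine lt_of_le_of_lt (lintegral_mono fun ω => ENNReal.ofReal_le_ofReal
      ((hf _).trans (hK (ε ω)))) ?_
    exact (hcov.const_mul K).lintegral_lt_top
  refine ⟨G, θ, ν, hν, hG, ?_, hnull, ?_, ?_, ?_⟩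
  · have := hlaw (fun _ => 1) measurable_const
    refine ⟨?_⟩
    simpa using this.symm
  · have := hlaw (fun z => ENNReal.ofReal (‖z.1‖ ^ 2)) (by fun_prop)
    rw [hν, ← this]
    exact hfin (fun z => ‖z.1‖ ^ 2) fun z => by
      have := norm_fst_le z
      gcongr
  · have := hlaw (fun z => ENNReal.ofReal (‖z.2.1‖ ^ 2)) (by fun_prop)
    rw [hν, ← this]
    exact hfin (fun z => ‖z.2.1‖ ^ 2) fun z => by
      have := (norm_fst_le z.2).trans (norm_snd_le z)
      gcongr
  · intro W hW
    obtain ⟨R, hR, hRu⟩ := exists_factor_of_posDef hW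
    set L : (Fin p → ℝ) →ₗ[ℝ] EuclideanSpace ℝ (Fin p) :=
      (WithLp.linearEquiv 2 ℝ (Fin p → ℝ)).symm.toLinearMap ∘ₗ R.mulVecLin with hL
    have hLn : ∀ u, ‖L u‖ ^ 2 = u ⬝ᵥ W *ᵥ u := by
      intro u
      rw [euclidean_norm_sq, hR, ← mulVec_mulVec, dotProduct_mulVec u, vecMul_transpose]
      rfl
    refine ⟨LinearMap.toContinuousLinearMap (L ∘ₗ B₁), LinearMap.toContinuousLinearMap (L ∘ₗ B₂),
      ?_, ?_, ?_⟩
    · intro a ha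
      have ha' : L (B₁ a) = 0 := ha
      have h1 := hLn (B₁ a)
      rw [ha', norm_zero] at h1
      have h2 : B₁ a = 0 := by
        by_contra h
        have := hW.dotProduct_mulVec_pos h
        rw [star_trivial, ← h1] at this
        norm_num at this
      have h3 := hCn a 0
      rw [h2, map_zero] at h3
      simpa using h3.symm
    · rintro rfl a v
      rw [← hCn, ← hLn, map_add]
      rfl
    · intro ψ hψ δ hδ
      have h := hlaw (fun z => ENNReal.ofReal (‖L (B₁ (ψ (‖z.1 + θ‖ ^ 2 /
              (q * (‖z.2.2‖ ^ 2 / ((n - p : ℕ) : ℝ)))) • (z.1 + θ) - θ)) + L (B₂ z.2.1)‖ ^ 2)) (by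
        have h1 : Measurable (LinearMap.toContinuousLinearMap (L ∘ₗ B₁)) :=
          (ContinuousLinearMap.continuous _).measurable
        have h2 : Measurable (LinearMap.toContinuousLinearMap (L ∘ₗ B₂)) :=
          (ContinuousLinearMap.continuous _).measurable
        change Measurable fun z : EuclideanSpace ℝ (Fin q) × (EuclideanSpace ℝ (Fin (p - q)) ×
          EuclideanSpace ℝ (Fin (n - p))) => ENNReal.ofReal
          (‖(LinearMap.toContinuousLinearMap (L ∘ₗ B₁)) (ψ (‖z.1 + θ‖ ^ 2 /
              (q * (‖z.2.2‖ ^ 2 / ((n - p : ℕ) : ℝ)))) • (z.1 + θ) - θ) +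
              (LinearMap.toContinuousLinearMap (L ∘ₗ B₂)) z.2.1‖ ^ 2)
        fun_prop)
      simp only [sub_add_cancel] at h
      refine Eq.trans ?_ h
      rw [risk]
      refine lintegral_congr fun ω => ?_
      obtain ⟨z, hz⟩ := T.surjective (ε ω)
      rw [← hz, T.symm_apply_apply, ← map_add, hLn]
      -- The restricted estimator has error -B₁θ + B₂v, and the difference of the two basic
      -- estimators is B₁(x + θ).
      have : δ (D.X *ᵥ β + T z) - β = B₁ (ψ (‖z.1 + θ‖ ^ 2 /
              (q * (‖z.2.2‖ ^ 2 / ((n - p : ℕ) : ℝ)))) • (z.1 + θ) - θ) + B₂ z.2.1 := by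
        rw [hδ, hstat, hres, hgls, map_sub, map_smul, map_add]
        module
      rw [this]

end Design

theorem posGain_le {n p q : ℕ} (hq : 3 ≤ q) (hpn : p < n) :
    posGain n p q ≤ 1 - shrink n p q := by
  rw [← integral_stein_fDist hq hpn]
  exact setIntegral_le_integral (integrable_stein_fDist hq (by omega) _)
    (ae_of_all _ fun x => by positivity)

theorem posGain_nonneg {n p q : ℕ} : 0 ≤ posGain n p q :=
  integral_nonneg fun x => by positivity

theorem distFun_nonneg {μ : Measure ℝ} {x : ℝ} : 0 ≤ distFun μ x := measureReal_nonneg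

/-! ### Null sets and finiteness under the canonical law. -/

section CanonicalLaw

variable {E₁ E₂ E₃ G : Type*}
  [NormedAddCommGroup E₁] [InnerProductSpace ℝ E₁] [FiniteDimensional ℝ E₁]
  [MeasurableSpace E₁] [BorelSpace E₁]
  [NormedAddCommGroup E₂] [InnerProductSpace ℝ E₂] [FiniteDimensional ℝ E₂]
  [MeasurableSpace E₂] [BorelSpace E₂]
  [NormedAddCommGroup E₃] [InnerProductSpace ℝ E₃] [FiniteDimensional ℝ E₃]
  [MeasurableSpace E₃] [BorelSpace E₃]
  [NormedAddCommGroup G] [NormedSpace ℝ G]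

/-- The exceptional set matters: if w = 0 or t = 0, division by zero sets the statistic to 0 and the
positive-rule factor to 0, while the corresponding positive part equals 1. -/
theorem canonicalLaw_ae_ne_zero [Nontrivial E₁] [Nontrivial E₃] (g : ℝ → ℝ≥0∞) (θ : E₁) :
    ∀ᵐ z ∂(canonicalLaw E₂ E₃ g θ), z.1 ≠ 0 ∧ z.2.2 ≠ 0 := by
  refine (withDensity_absolutelyContinuous _ _).ae_le ?_
  have h1 : ∀ᵐ w ∂(volume : Measure E₁), w ≠ 0 := Measure.ae_ne volume 0
  have h3 : ∀ᵐ t ∂(volume : Measure E₃), t ≠ 0 := Measure.ae_ne volume 0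
  have h1' := Measure.quasiMeasurePreserving_fst (μ := (volume : Measure E₁))
    (ν := (volume : Measure E₂).prod (volume : Measure E₃)) |>.ae h1
  have h3' := (Measure.quasiMeasurePreserving_snd (μ := (volume : Measure E₂))
    (ν := (volume : Measure E₃))).comp (Measure.quasiMeasurePreserving_snd
      (μ := (volume : Measure E₁))
    (ν := (volume : Measure E₂).prod (volume : Measure E₃))) |>.ae h3
  filter_upwards [h1', h3'] with z a b using ⟨a, b⟩

theorem lintegral_clm_lt_top {α E : Type*} [MeasurableSpace α] {ν : Measure α}
    [NormedAddCommGroup E] [NormedSpace ℝ E] (N : E →L[ℝ] G) {f : α → E}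
    (hf : ∫⁻ z, ENNReal.ofReal (‖f z‖ ^ 2) ∂ν < ⊤) :
    ∫⁻ z, ENNReal.ofReal (‖N (f z)‖ ^ 2) ∂ν < ⊤ := by
  have h : ∀ z, ENNReal.ofReal (‖N (f z)‖ ^ 2) ≤
      ENNReal.ofReal (‖N‖ ^ 2) * ENNReal.ofReal (‖f z‖ ^ 2) := by
    intro z
    rw [← ENNReal.ofReal_mul (by positivity), ← mul_pow]
    gcongr
    exact N.le_opNorm _
  refine (lintegral_mono h).trans_lt ?_
  rw [lintegral_const_mul' _ _ ENNReal.ofReal_ne_top]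
  exact ENNReal.mul_lt_top ENNReal.ofReal_lt_top hf

theorem lintegral_bounded_shrink_lt_top {α E : Type*} [MeasurableSpace α] {ν : Measure α}
    [IsFiniteMeasure ν] [NormedAddCommGroup E] [NormedSpace ℝ E] {f : α → E} {θ : E}
    (hf : ∫⁻ z, ENNReal.ofReal (‖f z - θ‖ ^ 2) ∂ν < ⊤) {a : α → ℝ} (ha0 : ∀ z, 0 ≤ a z)
    (ha1 : ∀ z, a z ≤ 1) :
    ∫⁻ z, ENNReal.ofReal (‖a z • f z - θ‖ ^ 2) ∂ν < ⊤ := by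
  have h : ∀ z, ENNReal.ofReal (‖a z • f z - θ‖ ^ 2) ≤
      ENNReal.ofReal 2 * ENNReal.ofReal (‖f z - θ‖ ^ 2) + ENNReal.ofReal (2 * ‖θ‖ ^ 2) := by
    intro z
    rw [← ENNReal.ofReal_mul (by positivity), ← ENNReal.ofReal_add (by positivity) (by positivity)]
    refine ENNReal.ofReal_le_ofReal ?_
    -- The shrunken vector lies between f and 0, so its distance to θ is controlled by ‖f - θ‖ and
    -- ‖θ‖.
    have e : a z • f z - θ = a z • (f z - θ) - (1 - a z) • θ := by module
    have h1 : ‖a z • f z - θ‖ ≤ ‖f z - θ‖ + ‖θ‖ := by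
      rw [e]
      refine (norm_sub_le _ _).trans (add_le_add ?_ ?_)
      · rw [norm_smul, Real.norm_of_nonneg (ha0 z)]
        exact mul_le_of_le_one_left (norm_nonneg _) (ha1 z)
      · rw [norm_smul, Real.norm_of_nonneg (by linarith [ha1 z])]
        exact mul_le_of_le_one_left (norm_nonneg _) (by linarith [ha0 z])
    calc ‖a z • f z - θ‖ ^ 2 ≤ (‖f z - θ‖ + ‖θ‖) ^ 2 := by gcongr
      _ ≤ _ := by nlinarith [sq_nonneg (‖f z - θ‖ - ‖θ‖)]
  refine (lintegral_mono h).trans_lt ?_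
  rw [lintegral_add_right _ measurable_const, lintegral_const_mul' _ _ ENNReal.ofReal_ne_top,
    lintegral_const]
  exact ENNReal.add_lt_top.2 ⟨ENNReal.mul_lt_top ENNReal.ofReal_lt_top hf,
    ENNReal.mul_lt_top ENNReal.ofReal_lt_top (measure_lt_top _ _)⟩

end CanonicalLaw

/-- The constant comes from dq/m = (q-2)/(m+2). No nonvanishing is needed, since both sides are 0
when a or b is. -/
theorem shrink_mul_inv_stat {n p q : ℕ} (hq : 3 ≤ q) (hpn : p < n) (a b : ℝ) :
    shrink n p q * (a ^ 2 / (q * (b ^ 2 / ((n - p : ℕ) : ℝ))))⁻¹ =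
      ((q : ℝ) - 2) / ((n - p : ℕ) + 2) * b ^ 2 / a ^ 2 := by
  have hm : (0 : ℝ) < ((n - p : ℕ) : ℝ) := by exact_mod_cast (by omega : 0 < n - p)
  have hq0 : (0 : ℝ) < q := by exact_mod_cast (by omega : 0 < q)
  rw [shrink, ← Nat.cast_sub hpn.le, inv_div]
  field_simp

theorem posPart_shrink_stat {n p q : ℕ} (hq : 3 ≤ q) (hpn : p < n) {a b : ℝ} (ha : a ≠ 0)
    (hb : b ≠ 0) :
    (if shrink n p q < a ^ 2 / (q * (b ^ 2 / ((n - p : ℕ) : ℝ))) then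
      1 - shrink n p q * (a ^ 2 / (q * (b ^ 2 / ((n - p : ℕ) : ℝ))))⁻¹ else 0) =
      max 0 (1 - ((q : ℝ) - 2) / ((n - p : ℕ) + 2) * b ^ 2 / a ^ 2) := by
  rw [← shrink_mul_inv_stat hq hpn]
  have hm : (0 : ℝ) < ((n - p : ℕ) : ℝ) := by exact_mod_cast (by omega : 0 < n - p)
  have hq0 : (0 : ℝ) < q := by exact_mod_cast (by omega : 0 < q)
  have hL : 0 < a ^ 2 / (q * (b ^ 2 / ((n - p : ℕ) : ℝ))) := by positivity
  set L := a ^ 2 / (q * (b ^ 2 / ((n - p : ℕ) : ℝ)))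
  rw [← div_eq_mul_inv]
  split_ifs with h
  · rw [max_eq_right]
    linarith [(div_lt_one hL).2 h]
  · rw [max_eq_left]
    linarith [(one_le_div hL).2 (not_lt.1 h)]

/-! ### The five estimators as shrinkage rules, and their risks. -/

namespace Design

/-- The factor of the Stein-type estimator, as a function of the test statistic. -/
def steinFactor (n p q : ℕ) (L : ℝ) : ℝ := 1 - shrink n p q * L⁻¹

/-- The factor of the positive-rule estimator. -/
def steinPosFactor (n p q : ℕ) (L : ℝ) : ℝ :=
  if shrink n p q < L then 1 - shrink n p q * L⁻¹ else 0

/-- The factor of the preliminary test estimator with critical value `c`. -/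
def prelimFactor (c L : ℝ) : ℝ := if c ≤ L then 1 else 0

theorem measurable_steinFactor {n p q : ℕ} : Measurable (steinFactor n p q) := by
  unfold steinFactor; fun_prop

theorem measurable_steinPosFactor {n p q : ℕ} : Measurable (steinPosFactor n p q) :=
  Measurable.ite measurableSet_Ioi measurable_steinFactor measurable_const

theorem measurable_prelimFactor {c : ℝ} : Measurable (prelimFactor c) :=
  Measurable.ite measurableSet_Ici measurable_const measurable_const

variable {n p q : ℕ} (D : Design n p q)

theorem gls_eq_shrinkage (y : Fin n → ℝ) :
    D.gls y = D.restricted y + (1 : ℝ) • (D.gls y - D.restricted y) := by module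

theorem restricted_eq_shrinkage (y : Fin n → ℝ) :
    D.restricted y = D.restricted y + (0 : ℝ) • (D.gls y - D.restricted y) := by module

theorem prelim_eq_shrinkage (α : ℝ) (y : Fin n → ℝ) :
    D.prelim α y = D.restricted y +
      prelimFactor (upperF q (n - p) α) (D.stat y) • (D.gls y - D.restricted y) := by
  unfold prelim prelimFactor
  split_ifs <;> module

theorem stein_eq_shrinkage (y : Fin n → ℝ) :
    D.stein y = D.restricted y + steinFactor n p q (D.stat y) • (D.gls y - D.restricted y) := by
  unfold stein steinFactor
  module

theorem steinPos_eq_shrinkage (y : Fin n → ℝ) :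
    D.steinPos y = D.restricted y +
      steinPosFactor n p q (D.stat y) • (D.gls y - D.restricted y) := by
  unfold steinPos steinPosFactor
  split_ifs <;> rfl

section Risk

variable {Ω : Type*} [MeasurableSpace Ω] {P : Measure Ω} [IsProbabilityMeasure P]
  {σ : ℝ} {g : ℝ → ℝ} {ε : Ω → Fin n → ℝ}

/-- The risk of a shrinkage estimator under the canonical law, up to the constant contribution of
the directions which satisfy the hypothesis. -/
theorem exists_canonical_risk_split (hqp : q < p) (hpn : p < n) (hg : Measurable g)
    (hε : HasEllipticalDensity P ε σ D.V g) (hcov : Integrable (fun ω => ε ω ⬝ᵥ ε ω) P)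
    (β : Fin p → ℝ) {W : Matrix (Fin p) (Fin p) ℝ} (hW : W.PosDef) :
    ∃ (G : ℝ → ℝ≥0∞) (θ : EuclideanSpace ℝ (Fin q))
      (N : EuclideanSpace ℝ (Fin q) →L[ℝ] EuclideanSpace ℝ (Fin p)) (c : ℝ≥0∞),
      Measurable G ∧ IsProbabilityMeasure (canonicalLaw (EuclideanSpace ℝ (Fin (p - q)))
        (EuclideanSpace ℝ (Fin (n - p))) G θ) ∧ (D.Null β → θ = 0) ∧
      ∫⁻ z, ENNReal.ofReal (‖z.1 - θ‖ ^ 2) ∂(canonicalLaw (EuclideanSpace ℝ (Fin (p - q)))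
        (EuclideanSpace ℝ (Fin (n - p))) G θ) < ⊤ ∧
      c < ⊤ ∧ (∀ a, N a = 0 → a = 0) ∧ (W = D.C → ∀ a, ‖N a‖ ^ 2 = ‖a‖ ^ 2) ∧
      ∀ ψ : ℝ → ℝ, Measurable ψ → ∀ δ : (Fin n → ℝ) → Fin p → ℝ,
        (∀ y, δ y = D.restricted y + ψ (D.stat y) • (D.gls y - D.restricted y)) →
        D.risk P ε W δ β = ∫⁻ z, ENNReal.ofReal (‖N (ψ (‖z.1‖ ^ 2 /
          (q * (‖z.2.2‖ ^ 2 / ((n - p : ℕ) : ℝ)))) • z.1 - θ)‖ ^ 2)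
          ∂(canonicalLaw (EuclideanSpace ℝ (Fin (p - q))) (EuclideanSpace ℝ (Fin (n - p))) G θ)
          + c := by
  obtain ⟨G, θ, ν, hν, hG, hprob, hnull, h1, h2, hW'⟩ :=
    D.exists_canonical_risk hqp hpn hg hε hcov β
  obtain ⟨N₁, N₂, hinj, hC, hrisk⟩ := hW' W hW
  subst hν
  refine ⟨G, θ, N₁, _, hG, hprob, hnull, h1, lintegral_clm_lt_top N₂ h2, hinj, ?_, ?_⟩
  · intro h a
    simpa using hC h a 0
  · intro ψ hψ δ hδ
    rw [hrisk ψ hψ δ hδ]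
    exact lintegral_loss_split hG θ N₁ N₂ (a := fun z => ψ (‖z.1‖ ^ 2 /
          (q * (‖z.2.2‖ ^ 2 / ((n - p : ℕ) : ℝ)))) • z.1 - θ) (by fun_prop) fun _ _ _ => rfl

/-- Finiteness and comparison of the risks at an arbitrary parameter. -/
theorem risk_facts (hq : 3 ≤ q) (hqp : q < p) (hpn : p < n) (hg : Measurable g)
    (hε : HasEllipticalDensity P ε σ D.V g) (hcov : Integrable (fun ω => ε ω ⬝ᵥ ε ω) P)
    (β : Fin p → ℝ) {W : Matrix (Fin p) (Fin p) ℝ} (hW : W.PosDef) :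
    (D.risk P ε W D.gls β < ⊤ ∧ D.risk P ε W D.restricted β < ⊤ ∧
      (∀ α, D.risk P ε W (D.prelim α) β < ⊤) ∧ D.risk P ε W D.stein β < ⊤) ∧
    D.risk P ε W D.steinPos β ≤ D.risk P ε W D.stein β ∧
    (W = D.C → D.risk P ε W D.stein β ≤ D.risk P ε W D.gls β) := by
  obtain ⟨G, θ, N, c, hG, hprob, -, h1, hc, -, hC, hrisk⟩ :=
    D.exists_canonical_risk_split hqp hpn hg hε hcov β hW
  have : Nontrivial (EuclideanSpace ℝ (Fin (n - p))) :=
    Module.nontrivial_of_finrank_pos (R := ℝ) (by rw [finrank_euclideanSpace_fin]; omega)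
  have : Nontrivial (EuclideanSpace ℝ (Fin q)) :=
    Module.nontrivial_of_finrank_pos (R := ℝ) (by rw [finrank_euclideanSpace_fin]; omega)
  set ν := canonicalLaw (EuclideanSpace ℝ (Fin (p - q))) (EuclideanSpace ℝ (Fin (n - p))) G θ
    with hν
  set k : ℝ := ((q : ℝ) - 2) / ((n - p : ℕ) + 2) with hk
  have hk0 : 0 ≤ k := by
    have hq3 : (3 : ℝ) ≤ q := by exact_mod_cast hq
    exact div_nonneg (by linarith) (by positivity)
  have hdim : 2 ≤ Module.finrank ℝ
      (EuclideanSpace ℝ (Fin (p - q)) × EuclideanSpace ℝ (Fin (n - p))) := by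
    rw [Module.finrank_prod, finrank_euclideanSpace_fin, finrank_euclideanSpace_fin]
    omega
  have hle := lintegral_canonicalLaw_stein_le (E₂ := EuclideanSpace ℝ (Fin (p - q)))
    (E₃ := EuclideanSpace ℝ (Fin (n - p))) hG θ hq finrank_euclideanSpace_fin
    finrank_euclideanSpace_fin hk
  -- The Stein factor is unbounded below, so its finiteness is not elementary: it is taken from
  -- Stein's inequality in the unweighted norm and passed to every W through the bounded map `N`.
  have hpos := lintegral_positivePart_le hG θ hdim hk0 (hle.trans_lt h1) N
  have hbdd : ∀ ψ : ℝ → ℝ, Measurable ψ → (∀ L, 0 ≤ ψ L) → (∀ L, ψ L ≤ 1) →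
      ∀ δ : (Fin n → ℝ) → Fin p → ℝ,
        (∀ y, δ y = D.restricted y + ψ (D.stat y) • (D.gls y - D.restricted y)) →
        D.risk P ε W δ β < ⊤ := by
    intro ψ hψ h0 h1' δ hδ
    rw [hrisk ψ hψ δ hδ]
    exact ENNReal.add_lt_top.2 ⟨lintegral_clm_lt_top N
      (lintegral_bounded_shrink_lt_top h1 (fun _ => h0 _) fun _ => h1' _), hc⟩
  have hS := hrisk _ measurable_steinFactor _ D.stein_eq_shrinkage
  have hP := hrisk _ measurable_steinPosFactor _ D.steinPos_eq_shrinkage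
  have hL := hrisk _ measurable_const _ D.gls_eq_shrinkage
  simp only [steinFactor, shrink_mul_inv_stat hq hpn, ← hk] at hS
  simp only [one_smul] at hL
  refine ⟨⟨?_, ?_, fun α => ?_, ?_⟩, ?_, ?_⟩
  · exact hbdd _ measurable_const (fun _ => zero_le_one) (fun _ => le_rfl) _ D.gls_eq_shrinkage
  · exact hbdd _ measurable_const (fun _ => le_rfl) (fun _ => zero_le_one) _
      D.restricted_eq_shrinkage
  · refine hbdd _ measurable_prelimFactor (fun L => ?_) (fun L => ?_) _
      (D.prelim_eq_shrinkage α) <;> unfold prelimFactor <;> split_ifs <;> norm_num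
  · rw [hS]
    exact ENNReal.add_lt_top.2 ⟨lintegral_clm_lt_top N (hle.trans_lt h1), hc⟩
  · rw [hS, hP]
    refine add_le_add_left (le_trans (le_of_eq (lintegral_congr_ae ?_)) hpos) c
    filter_upwards [canonicalLaw_ae_ne_zero G θ] with z hz
    rw [steinPosFactor, posPart_shrink_stat hq hpn (norm_ne_zero_iff.2 hz.1)
      (norm_ne_zero_iff.2 hz.2)]
  · intro hWC
    rw [hS, hL]
    simp only [hC hWC]
    exact add_le_add_left hle c

/-- The risks of the five estimators under the null hypothesis, up to a common affine
transformation. -/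
theorem exists_null_risk (hq : 3 ≤ q) (hqp : q < p) (hpn : p < n) (hg : Measurable g)
    (hε : HasEllipticalDensity P ε σ D.V g) (hcov : Integrable (fun ω => ε ω ⬝ᵥ ε ω) P)
    {β : Fin p → ℝ} (hβ : D.Null β) {W : Matrix (Fin p) (Fin p) ℝ} (hW : W.PosDef) :
    ∃ K c : ℝ≥0∞, K ≠ 0 ∧ K ≠ ⊤ ∧ c ≠ ⊤ ∧
      D.risk P ε W D.restricted β = c ∧
      D.risk P ε W D.gls β = K * ENNReal.ofReal 1 + c ∧
      (∀ α, D.risk P ε W (D.prelim α) β = K * ENNReal.ofReal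
        (1 - distFun (fDist (q + 2) (n - p)) (q * upperF q (n - p) α / (q + 2))) + c) ∧
      D.risk P ε W D.stein β = K * ENNReal.ofReal (1 - shrink n p q) + c ∧
      D.risk P ε W D.steinPos β =
        K * ENNReal.ofReal (1 - shrink n p q - posGain n p q) + c := by
  obtain ⟨G, θ, N, c, hG, hprob, hnull, h1, hc, hinj, -, hrisk⟩ :=
    D.exists_canonical_risk_split hqp hpn hg hε hcov β hW
  obtain rfl := hnull hβ
  have : Nontrivial (EuclideanSpace ℝ (Fin (n - p))) :=
    Module.nontrivial_of_finrank_pos (R := ℝ) (by rw [finrank_euclideanSpace_fin]; omega)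
  have : Nontrivial (EuclideanSpace ℝ (Fin q)) :=
    Module.nontrivial_of_finrank_pos (R := ℝ) (by rw [finrank_euclideanSpace_fin]; omega)
  have hfd := isProbabilityMeasure_fDist (a := q + 2) (b := n - p) (by omega) (by omega)
  obtain ⟨K, hK⟩ := lintegral_canonicalLaw_null (E₁ := EuclideanSpace ℝ (Fin q))
    (E₂ := EuclideanSpace ℝ (Fin (p - q))) (E₃ := EuclideanSpace ℝ (Fin (n - p)))
    finrank_euclideanSpace_fin finrank_euclideanSpace_fin hG
    (A := fun w => ENNReal.ofReal (‖N w‖ ^ 2)) (by fun_prop) (by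
      intro y r hr
      rw [← ENNReal.ofReal_mul (by positivity), map_smul, norm_smul, Real.norm_of_nonneg hr.le,
        mul_pow])
  set ν := canonicalLaw (EuclideanSpace ℝ (Fin (p - q))) (EuclideanSpace ℝ (Fin (n - p))) G
    (0 : EuclideanSpace ℝ (Fin q)) with hν
  -- Taking ψ = 1 identifies K as E‖Nw‖². It is finite by the second moment, and nonzero because N
  -- is injective and w ≠ 0 almost surely.
  have hmass : ∫⁻ z, ENNReal.ofReal (‖N z.1‖ ^ 2) ∂ν = K := by
    have := hK (fun _ => 1) measurable_const
    simpa using this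
  simp only [sub_zero] at h1 hrisk
  have hnullrisk : ∀ ψ : ℝ → ℝ, Measurable ψ → ∀ δ : (Fin n → ℝ) → Fin p → ℝ,
        (∀ y, δ y = D.restricted y + ψ (D.stat y) • (D.gls y - D.restricted y)) →
        D.risk P ε W δ β = K * ∫⁻ x, ENNReal.ofReal (ψ (((q : ℝ) + 2) / q * x) ^ 2)
          ∂(fDist (q + 2) (n - p)) + c := by
    intro ψ hψ δ hδ
    rw [hrisk ψ hψ δ hδ, ← hK (fun L => ENNReal.ofReal (ψ L ^ 2)) (by fun_prop)]
    congr 1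
    refine lintegral_congr fun z => ?_
    rw [map_smul, norm_smul, mul_pow, Real.norm_eq_abs, sq_abs, mul_comm,
      ENNReal.ofReal_mul (by positivity)]
  refine ⟨K, c, ?_, ?_, hc.ne, ?_, ?_, fun α => ?_, ?_, ?_⟩
  · intro h0
    rw [h0, lintegral_eq_zero_iff (by fun_prop)] at hmass
    have hfalse : ∀ᵐ z ∂ν, False := by
      filter_upwards [hmass, canonicalLaw_ae_ne_zero G 0] with z hz hz1
      refine hz1.1 (hinj _ ?_)
      simpa [ENNReal.ofReal_eq_zero] using hz
    have := hprob.ne_zero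
    simp at hfalse
    exact this hfalse
  · rw [← hmass]
    exact (lintegral_clm_lt_top N h1).ne
  · rw [hnullrisk _ measurable_const _ D.restricted_eq_shrinkage]
    simp
  · rw [hnullrisk _ measurable_const _ D.gls_eq_shrinkage]
    simp
  · rw [hnullrisk _ measurable_prelimFactor _ (D.prelim_eq_shrinkage α)]
    rw [← lintegral_prelim_fDist (by omega) (by omega)]
    rfl
  · rw [hnullrisk _ measurable_steinFactor _ D.stein_eq_shrinkage, ← lintegral_stein_fDist hq hpn]
    rfl
  · rw [hnullrisk _ measurable_steinPosFactor _ D.steinPos_eq_shrinkage,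
      ← lintegral_steinPos_fDist hq hpn]
    rfl

end Risk

end Design

end EllipticalRegression

end

/-! ### The dominance theorem. -/

theorem mainTheorem5 {Ω : Type*} [MeasurableSpace Ω] (P : Measure Ω) [IsProbabilityMeasure P]
    {n p q : ℕ} (hq : 3 ≤ q) (hqp : q < p) (hpn : p < n)
    (D : EllipticalRegression.Design n p q)
    (σ : ℝ) (hσ : 0 < σ) (g : ℝ → ℝ) (hg : Measurable g) (hg0 : ∀ y, 0 < y → 0 ≤ g y)
    (ε : Ω → Fin n → ℝ) (hε : EllipticalRegression.HasEllipticalDensity P ε σ D.V g)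
    (hcov : Integrable (fun ω => ε ω ⬝ᵥ ε ω) P) :
    -- all risks are finite
    (∀ W : Matrix (Fin p) (Fin p) ℝ, W.PosDef → ∀ α : ℝ, 0 < α → α < 1 → ∀ β : Fin p → ℝ,
      D.risk P ε W D.gls β < ⊤ ∧ D.risk P ε W D.restricted β < ⊤ ∧
      D.risk P ε W (D.prelim α) β < ⊤ ∧ D.risk P ε W D.stein β < ⊤ ∧
      D.risk P ε W D.steinPos β < ⊤) ∧
    -- the positive-rule estimator improves on the Stein-type estimator everywhere
    (∀ W : Matrix (Fin p) (Fin p) ℝ, W.PosDef → ∀ β : Fin p → ℝ,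
      D.risk P ε W D.steinPos β ≤ D.risk P ε W D.stein β) ∧
    -- for the weight `W = C`, both improve on generalized least squares everywhere
    (∀ β : Fin p → ℝ,
      D.risk P ε D.C D.steinPos β ≤ D.risk P ε D.C D.stein β ∧
      D.risk P ε D.C D.stein β ≤ D.risk P ε D.C D.gls β ∧
      D.risk P ε D.C D.steinPos β ≤ D.risk P ε D.C D.gls β) ∧
    -- comparisons under the null hypothesis
    (∀ W : Matrix (Fin p) (Fin p) ℝ, W.PosDef → ∀ α : ℝ, 0 < α → α < 1 →
      ∀ β : Fin p → ℝ, D.Null β →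
      -- the restricted estimator is the best of the five
      (D.risk P ε W D.restricted β ≤ D.risk P ε W D.gls β ∧
        D.risk P ε W D.restricted β ≤ D.risk P ε W (D.prelim α) β ∧
        D.risk P ε W D.restricted β ≤ D.risk P ε W D.stein β ∧
        D.risk P ε W D.restricted β ≤ D.risk P ε W D.steinPos β) ∧
      -- first ordering, together with the exact range of levels `α` for which it holds
      (EllipticalRegression.posGain n p q ≤
          EllipticalRegression.distFun (EllipticalRegression.fDist (q + 2) (n - p))
            (q * EllipticalRegression.upperF q (n - p) α / (q + 2))
            - EllipticalRegression.shrink n p q ↔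
        (D.risk P ε W D.restricted β ≤ D.risk P ε W (D.prelim α) β ∧
          D.risk P ε W (D.prelim α) β ≤ D.risk P ε W D.steinPos β ∧
          D.risk P ε W D.steinPos β ≤ D.risk P ε W D.stein β ∧
          D.risk P ε W D.stein β ≤ D.risk P ε W D.gls β)) ∧
      -- second ordering
      (q * EllipticalRegression.upperF q (n - p) α / (q + 2) <
          EllipticalRegression.quantile (EllipticalRegression.fDist (q + 2) (n - p))
            (EllipticalRegression.shrink n p q) →
        D.risk P ε W D.restricted β ≤ D.risk P ε W D.steinPos β ∧
        D.risk P ε W D.steinPos β ≤ D.risk P ε W D.stein β ∧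
        D.risk P ε W D.stein β ≤ D.risk P ε W (D.prelim α) β ∧
        D.risk P ε W (D.prelim α) β ≤ D.risk P ε W D.gls β)) := by
  have hCpd := EllipticalRegression.Design.C_posDef D
  have facts := fun (β : Fin p → ℝ) (W : Matrix (Fin p) (Fin p) ℝ) (hW : W.PosDef) =>
    D.risk_facts hq hqp hpn hg hε hcov β hW
  refine ⟨fun W hW α _ _ β => ?_, fun W hW β => (facts β W hW).2.1, fun β => ?_,
    fun W hW α _ _ β hβ => ?_⟩
  · obtain ⟨⟨h1, h2, h3, h4⟩, h5, -⟩ := facts β W hW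
    exact ⟨h1, h2, h3 α, h4, h5.trans_lt h4⟩
  · obtain ⟨-, h1, h2⟩ := facts β D.C hCpd
    exact ⟨h1, h2 rfl, h1.trans (h2 rfl)⟩
  · obtain ⟨K, c, hK0, hKt, hct, hR, hL, hPT, hS, hP⟩ :=
      D.exists_null_risk hq hqp hpn hg hε hcov hβ hW
    -- Cancelling the common finite c and the finite nonzero K leaves inequalities between relative
    -- risks that depend neither on g nor on W.
    have cmp : ∀ a b : ℝ, K * ENNReal.ofReal a + c ≤ K * ENNReal.ofReal b + c ↔
        ENNReal.ofReal a ≤ ENNReal.ofReal b := fun a b => by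
      rw [ENNReal.add_le_add_iff_right hct, ENNReal.mul_le_mul_iff_right hK0 hKt]
    have hd := EllipticalRegression.shrink_pos hq hpn
    have hpg := EllipticalRegression.posGain_le hq hpn
    have hpg0 := EllipticalRegression.posGain_nonneg (n := n) (p := p) (q := q)
    have hdF := EllipticalRegression.distFun_nonneg
      (μ := EllipticalRegression.fDist (q + 2) (n - p))
      (x := q * EllipticalRegression.upperF q (n - p) α / (q + 2))
    rw [hR, hL, hPT α, hS, hP]
    simp only [cmp]
    refine ⟨⟨le_add_self, le_add_self, le_add_self, le_add_self⟩, ⟨fun h => ?_, fun h => ?_⟩,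
      fun h => ?_⟩
    · exact ⟨le_add_self, ENNReal.ofReal_le_ofReal (by linarith),
        ENNReal.ofReal_le_ofReal (by linarith), ENNReal.ofReal_le_ofReal (by linarith)⟩
    -- Truncation at 0 loses nothing here, because 1 - d - `posGain` is nonnegative by `posGain_le`.
    -- The preliminary test comparison is the only link of the chain that constrains α.
    · have := (ENNReal.ofReal_le_ofReal_iff (by linarith)).1 h.2.1
      linarith
    · have := EllipticalRegression.distFun_lt_of_lt_quantile (by omega) (by omega) hd h
      exact ⟨le_add_self, ENNReal.ofReal_le_ofReal (by linarith),
        ENNReal.ofReal_le_ofReal (by linarith), ENNReal.ofReal_le_ofReal (by linarith)⟩
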